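/- **Setting (HDFOLR).** A signature $\Delta$ consists of a set $F^{\mathsf n}$ of nominals, a set of binary modalities, and a many-sorted first-order signature $\Sigma$ (sorts, function and relation symbols) with a subsignature $\Sigma^{\mathsf r}\subseteq\Sigma$ of rigid symbols. $\Delta$ is *countable* if it has countably many symbols. A Kripke structure $M$ over $\Delta$ has a non-empty set $W$ of worlds, an element $W_k\in W$ for each nominal $k$, a binary relation on $W$ for each modality, and for each $w\in W$ a first-order $\Sigma$-structure $M_w$ with non-empty carriers, all $M_w$ having the same $\Sigma^{\mathsf r}$-reduct. Actions are built from modalities by composition, union and iteration. Hybrid terms are built from the symbols of $\Sigma$ and from the symbols $@_k\sigma$ with $\sigma$ flexible ("$\sigma$ evaluated at the world named $k$"); a term is rigid if all its flexible symbols carry some $@_k$. Sentences are built from nominals, equations and relational atoms over hybrid terms by $@_k$ (retrieve), negation, finite disjunction, store $\downarrow\! z$, existential quantification over finite sets of nominal variables and variables of rigid sorts, and possibility $\langle\mathfrak a\rangle$ over actions $\mathfrak a$. $M\models^w\gamma$ is the usual local satisfaction, and $M\models\gamma$ means $M\models^w\gamma$ for all worlds $w$; $T\models\Gamma$ means that every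 $M$ satisfying $T$ satisfies $\Gamma$. $\Delta[C]$ is $\Delta$ with a set $C$ of new nominals and new rigid constants. A substitution over $\Delta$ maps such new constants to nominals and rigid terms. A *fragment* $\mathcal L$ is given by a subcategory of the category of signatures and a subfunctor $\mathsf{Sen}$ of the sentence functor, closed under the inclusions $\Delta\hookrightarrow\Delta[C]$, under substitutions, and under subsentences. $\mathcal L$ is *semantically closed* under a sentence-building operator if the result of applying it to $\mathcal L$-sentences is always locally equivalent (satisfied at the same worlds of all Kripke structures) to an $\mathcal L$-sentence; closure under equality means this for nominals $k$ and for all equations between hybrid terms. *Omitting types.* A type in a finite set $X$ of variables over $\Delta$ is a set $\Gamma\subseteq\mathsf{Sen}(\Delta[X])$. A structure over $\Delta$ omits $\Gamma$ if none of its expansions to $\Delta[X]$ satisfies $\Gamma$. A theory $T\subseteq\mathsf{Sen}(\Delta)$ locally realizes $\Gamma$ if there are a finite set $C$ of new constants, a substitution $\theta:X\to C$ over $\Delta$ and a finite $p\subseteq\mathsf{Sen}(\Delta[C])$ such that $T\cup p$ is satisfiable and $T\cup p\models\theta(\Gamma)$; otherwise $T$ locally omits $\Gamma$. $\mathcal L$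 has the $\omega$-omitting types property ($\omega$-OTP) if for every countable signature $\Delta$ of $\mathcal L$, every satisfiable $T\subseteq\mathsf{Sen}(\Delta)$ and all types $\Gamma^i$ $(i<\omega)$ locally omitted by $T$, some Kripke structure over $\Delta$ satisfies $T$ and omits all $\Gamma^i$. *Entailment.* An entailment relation for $\mathcal L$ is a family $\vdash=(\vdash_\Delta)_\Delta$ of binary relations between sets of $\mathcal L$-sentences satisfying: monotonicity ($\Phi_2\vdash\Phi_1$ if $\Phi_1\subseteq\Phi_2$), transitivity, union ($\Phi_1\vdash\Phi_2$ if $\Phi_1\vdash\varphi$ for all $\varphi\in\Phi_2$), and translation along the signature morphisms of $\mathcal L$. It is complete if $\models\;\subseteq\;\vdash$. *The logic $\mathcal L^{\mathsf c}$.* Its signatures are pairs $(\Delta,\Sigma^{\mathsf c})$ with $\Delta$ a signature of $\mathcal L$ and $\Sigma^{\mathsf c}$ a set of rigid function symbols of $\Delta$, the constructors. A rigid sort is constrained if some constructor has it as its result sort, and loose otherwise; let $Y$ consist of countably infinitely many variables of each loose sort. A Kripke structure over $\Delta$ is constructor-based if every world is the denotation of a nominal and every element of a rigid sort is the denotation,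 under some interpretation of $Y$, of a term $t\in T_{\Sigma^{\mathsf c}}(Y)$. $\Phi\models^{\mathsf c}\Psi$ means that every constructor-based Kripke structure satisfying $\Phi$ satisfies $\Psi$. For an arbitrary class $\mathcal M$ of morphisms of $\mathcal L$ that preserve constructors (the signature morphisms of $\mathcal L^{\mathsf c}$), $\vdash^{\mathsf c}$ is the least family of relations, indexed by the pairs $(\Delta,\Sigma^{\mathsf c})$, that is closed under monotonicity, transitivity, union, translation along $\mathcal M$, and * (R0) if $\Phi\vdash\varphi$ then $\Phi\vdash^{\mathsf c}\varphi$; * (R1) if $\Phi\vdash^{\mathsf c}@_{k_1}\varphi(k_2)$ for all $k_1,k_2\in F^{\mathsf n}$ then $\Phi\vdash^{\mathsf c}\forall x\,\varphi(x)$, where $x$ is a nominal variable; * (R2) if $\Phi\vdash^{\mathsf c}@_k\forall Y_t\,\psi(t)$ for all $k\in F^{\mathsf n}$ and all $t\in T_{\Sigma^{\mathsf c}}(Y)$ of the sort of $y$ then $\Phi\vdash^{\mathsf c}\forall y\,\psi(y)$, where $y$ is a variable of constrained sort and $Y_t$ is the set of variables occurring in $t$ (sentences such as $@_{k_1}\varphi(k_2)$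 and $\forall x\,\varphi(x)$ stand for $\mathcal L$-sentences locally equivalent to them). **Theorem (Constructor-based completeness).** Let $\mathcal L$ be a fragment of HDFOLR that is semantically closed under equality, negation, retrieve, disjunction and quantifiers, and let $\vdash$ be a complete entailment relation for $\mathcal L$. If $\mathcal L$ has $\omega$-OTP, then $\vdash^{\mathsf c}$ is complete for $\mathcal L^{\mathsf c}$ over countable signatures: for every signature $(\Delta,\Sigma^{\mathsf c})$ of $\mathcal L^{\mathsf c}$ with $\Delta$ countable and all sets $\Phi,\Psi$ of $\mathcal L$-sentences over $\Delta$, if $\Phi\models^{\mathsf c}\Psi$ then $\Phi\vdash^{\mathsf c}\Psi$. -/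

import Mathlib

universe u

namespace HDFOLR

/-! ## Signatures -/

/-- An arity over a set of sorts: a finite string of sorts. -/
structure Arity (S : Type u) : Type u where
  n : ℕ
  dom : Fin n → S

namespace Arity

/-- The empty arity. -/
def nil {S : Type u} : Arity S := ⟨0, Fin.elim0⟩

/-- Sortwise translation of an arity. -/
def map {S S' : Type u} (g : S → S') (a : Arity S) : Arity S' := ⟨a.n, fun i => g (a.dom i)⟩

theorem map_id {S : Type u} (a : Arity S) : a.map id = a := rfl

theorem map_map {S S' S'' : Type u} (g : S → S') (g' : S' → S'') (a : Arity S) :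
    (a.map g).map g' = a.map (g' ∘ g) := rfl

theorem map_nil {S S' : Type u} (g : S → S') : (nil : Arity S).map g = nil := by
  unfold nil map
  congr 1
  funext i
  exact i.elim0

end Arity

/-- A signature of hybrid-dynamic first-order logic with rigid symbols: a set of nominals, a set
of (binary) modalities, and a many-sorted first-order signature in which sorts, function symbols
and relation symbols are split into rigid and flexible ones. The rigid symbols form a first-order
subsignature: rigid function and relation symbols have rigid arities and sorts. -/
structure Signature : Type (u + 1) where
  Nom : Type u
  Mod : Type u
  RSort : Type u
  FSort : Type u
  RFunc : Type u
  FFunc : Type u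
  RRel : Type u
  FRel : Type u
  rar : RFunc → Arity RSort
  rcod : RFunc → RSort
  far : FFunc → Arity (RSort ⊕ FSort)
  fcod : FFunc → RSort ⊕ FSort
  rrar : RRel → Arity RSort
  frar : FRel → Arity (RSort ⊕ FSort)

namespace Signature

variable (Δ : Signature.{u})

/-- All (ordinary) sorts. -/
abbrev Srt : Type u := Δ.RSort ⊕ Δ.FSort

/-- All function symbols. -/
abbrev Func : Type u := Δ.RFunc ⊕ Δ.FFunc

/-- All relation symbols. -/
abbrev Rel : Type u := Δ.RRel ⊕ Δ.FRel

def ar : Δ.Func → Arity Δ.Srt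
  | Sum.inl f => (Δ.rar f).map Sum.inl
  | Sum.inr f => Δ.far f

def cod : Δ.Func → Δ.Srt
  | Sum.inl f => Sum.inl (Δ.rcod f)
  | Sum.inr f => Δ.fcod f

def relAr : Δ.Rel → Arity Δ.Srt
  | Sum.inl p => (Δ.rrar p).map Sum.inl
  | Sum.inr p => Δ.frar p

/-- The power of a signature: the number of its symbols, but at least `ℵ₀`. -/
noncomputable def power : Cardinal.{u} :=
  max Cardinal.aleph0
    (Cardinal.mk Δ.Nom + Cardinal.mk Δ.Mod + Cardinal.mk Δ.RSort + Cardinal.mk Δ.FSort +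
      Cardinal.mk Δ.RFunc + Cardinal.mk Δ.FFunc + Cardinal.mk Δ.RRel + Cardinal.mk Δ.FRel)

/-- Hybrid sorts: the rigid sorts, the flexible sorts `s` (location `none`, the current world), and
the sorts `@ₖ s` for `s` flexible (location `some k`). -/
abbrev HSort : Type u := Δ.RSort ⊕ (Option Δ.Nom × Δ.FSort)

/-- The hybrid sort `s` (for `none`) or `@ₖ s` (for `some k`); `@ₖ s = s` when `s` is rigid. -/
def hs (l : Option Δ.Nom) : Δ.Srt → Δ.HSort
  | Sum.inl s => Sum.inl s
  | Sum.inr s => Sum.inr (l, s)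

end Signature

/-- A set of new nominals (`N`) and of new rigid constants (`D`, with their rigid sorts). -/
structure Consts (Δ : Signature.{u}) : Type (u + 1) where
  N : Type u
  D : Type u
  srt : D → Δ.RSort

/-- A finite set of variables of extended rigid sorts: `n` nominal variables and `m` variables of
rigid sorts. -/
structure Vars (Δ : Signature.{u}) : Type u where
  n : ℕ
  m : ℕ
  srt : Fin m → Δ.RSort

namespace Vars

variable {Δ : Signature.{u}}

/-- A finite set of variables, regarded as a set of new constants. -/
def toConsts (X : Vars Δ) : Consts Δ where
  N := ULift.{u} (Fin X.n)
  D := ULift.{u} (Fin X.m)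
  srt d := X.srt d.down

/-- A single nominal variable. -/
def nominal (Δ : Signature.{u}) : Vars Δ := ⟨1, 0, Fin.elim0⟩

/-- A single variable of rigid sort `s`. -/
def single (s : Δ.RSort) : Vars Δ := ⟨0, 1, fun _ => s⟩

end Vars

/-- The signature `Δ[C]`, obtained by adding the elements of `C` as new nominals and new rigid
constants. -/
def Signature.ext (Δ : Signature.{u}) (C : Consts Δ) : Signature.{u} where
  Nom := Δ.Nom ⊕ C.N
  Mod := Δ.Mod
  RSort := Δ.RSort
  FSort := Δ.FSort
  RFunc := Δ.RFunc ⊕ C.D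
  FFunc := Δ.FFunc
  RRel := Δ.RRel
  FRel := Δ.FRel
  rar := Sum.elim Δ.rar (fun _ => Arity.nil)
  rcod := Sum.elim Δ.rcod C.srt
  far := Δ.far
  fcod := Δ.fcod
  rrar := Δ.rrar
  frar := Δ.frar

/-- The signature `Δ[X]` for a finite set `X` of variables. -/
abbrev Signature.extv (Δ : Signature.{u}) (X : Vars Δ) : Signature.{u} := Δ.ext X.toConsts

/-! ## Signature morphisms -/

/-- The part of a signature morphism that does not concern the rigid function symbols. A flexible
symbol may be mapped to a rigid one, a rigid symbol is mapped to a rigid one. -/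
structure PreHom (Δ Δ' : Signature.{u}) : Type u where
  nom : Δ.Nom → Δ'.Nom
  mod : Δ.Mod → Δ'.Mod
  rs : Δ.RSort → Δ'.RSort
  fs : Δ.FSort → Δ'.Srt
  ff : Δ.FFunc → Δ'.Func
  rr : Δ.RRel → Δ'.RRel
  fr : Δ.FRel → Δ'.Rel
  ff_ar : ∀ f, Δ'.ar (ff f) = (Δ.far f).map (Sum.elim (Sum.inl ∘ rs) fs)
  ff_cod : ∀ f, Δ'.cod (ff f) = Sum.elim (Sum.inl ∘ rs) fs (Δ.fcod f)
  rr_ar : ∀ p, Δ'.rrar (rr p) = (Δ.rrar p).map rs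
  fr_ar : ∀ p, Δ'.relAr (fr p) = (Δ.frar p).map (Sum.elim (Sum.inl ∘ rs) fs)

namespace PreHom

variable {Δ Δ' : Signature.{u}} (χ : PreHom Δ Δ')

/-- The map on all sorts. -/
def smap : Δ.Srt → Δ'.Srt := Sum.elim (Sum.inl ∘ χ.rs) χ.fs

/-- The map on hybrid sorts. -/
def hmap : Δ.HSort → Δ'.HSort
  | Sum.inl s => Sum.inl (χ.rs s)
  | Sum.inr (l, s) => Δ'.hs (l.map χ.nom) (χ.fs s)

/-- Translation of sets of constants. -/
def mapConsts (C : Consts Δ) : Consts Δ' where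
  N := C.N
  D := C.D
  srt d := χ.rs (C.srt d)

/-- Translation of finite sets of variables. -/
def mapVars (X : Vars Δ) : Vars Δ' where
  n := X.n
  m := X.m
  srt i := χ.rs (X.srt i)

end PreHom

/-- Signature morphisms `Δ → Δ'`. -/
structure Hom (Δ Δ' : Signature.{u}) : Type u extends PreHom Δ Δ' where
  rf : Δ.RFunc → Δ'.RFunc
  rf_ar : ∀ f, Δ'.rar (rf f) = (Δ.rar f).map rs
  rf_cod : ∀ f, Δ'.rcod (rf f) = rs (Δ.rcod f)

theorem sumElim_inl_id_inr (A B : Type u) :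
    (Sum.elim (Sum.inl ∘ id) Sum.inr : A ⊕ B → A ⊕ B) = id := by
  funext s; cases s <;> rfl

namespace Hom

/-- The inclusion `Δ ↪ Δ[C]`. -/
def incl (Δ : Signature.{u}) (C : Consts Δ) : Hom Δ (Δ.ext C) where
  nom := Sum.inl
  mod := id
  rs := id
  fs := Sum.inr
  ff := Sum.inr
  rr := id
  fr := Sum.inr
  ff_ar f := by
    change Δ.far f = (Δ.far f).map (Sum.elim (Sum.inl ∘ id) Sum.inr)
    rw [sumElim_inl_id_inr, Arity.map_id]
  ff_cod f := by
    change Δ.fcod f = Sum.elim (Sum.inl ∘ id) Sum.inr (Δ.fcod f)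
    rw [sumElim_inl_id_inr]; rfl
  rr_ar _ := rfl
  fr_ar p := by
    change Δ.frar p = (Δ.frar p).map (Sum.elim (Sum.inl ∘ id) Sum.inr)
    rw [sumElim_inl_id_inr, Arity.map_id]
  rf := Sum.inl
  rf_ar _ := rfl
  rf_cod _ := rfl

/-- The identity morphism. -/
def id (Δ : Signature.{u}) : Hom Δ Δ where
  nom := _root_.id
  mod := _root_.id
  rs := _root_.id
  fs := Sum.inr
  ff := Sum.inr
  rr := _root_.id
  fr := Sum.inr
  ff_ar f := by
    change Δ.far f = (Δ.far f).map (Sum.elim (Sum.inl ∘ _root_.id) Sum.inr)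
    rw [sumElim_inl_id_inr, Arity.map_id]
  ff_cod f := by
    change Δ.fcod f = Sum.elim (Sum.inl ∘ _root_.id) Sum.inr (Δ.fcod f)
    rw [sumElim_inl_id_inr]; rfl
  rr_ar _ := rfl
  fr_ar p := by
    change Δ.frar p = (Δ.frar p).map (Sum.elim (Sum.inl ∘ _root_.id) Sum.inr)
    rw [sumElim_inl_id_inr, Arity.map_id]
  rf := _root_.id
  rf_ar _ := rfl
  rf_cod _ := rfl

variable {Δ Δ' Δ'' : Signature.{u}}

/-- The map on all function symbols. -/
def fmap (χ : Hom Δ Δ') : Δ.Func → Δ'.Func := Sum.elim (Sum.inl ∘ χ.rf) χ.ff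

/-- The map on all relation symbols. -/
def pmap (χ : Hom Δ Δ') : Δ.Rel → Δ'.Rel := Sum.elim (Sum.inl ∘ χ.rr) χ.fr

theorem ar_fmap (χ : Hom Δ Δ') (f : Δ.Func) : Δ'.ar (χ.fmap f) = (Δ.ar f).map χ.smap := by
  cases f with
  | inl f =>
    change (Δ'.rar (χ.rf f)).map Sum.inl = _
    rw [χ.rf_ar]; rfl
  | inr f => exact χ.ff_ar f

theorem cod_fmap (χ : Hom Δ Δ') (f : Δ.Func) : Δ'.cod (χ.fmap f) = χ.smap (Δ.cod f) := by
  cases f with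
  | inl f =>
    change Sum.inl (Δ'.rcod (χ.rf f)) = _
    rw [χ.rf_cod]; rfl
  | inr f => exact χ.ff_cod f

theorem relAr_pmap (χ : Hom Δ Δ') (p : Δ.Rel) :
    Δ'.relAr (χ.pmap p) = (Δ.relAr p).map χ.smap := by
  cases p with
  | inl p =>
    change (Δ'.rrar (χ.rr p)).map Sum.inl = _
    rw [χ.rr_ar]; rfl
  | inr p => exact χ.fr_ar p

theorem smap_comp_smap (χ : PreHom Δ Δ') (ψ : PreHom Δ' Δ'') :
    ψ.smap ∘ χ.smap = Sum.elim (Sum.inl ∘ (ψ.rs ∘ χ.rs)) (ψ.smap ∘ χ.fs) := by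
  funext s; cases s <;> rfl

/-- Composition of signature morphisms (in diagrammatic order). -/
def comp (χ : Hom Δ Δ') (ψ : Hom Δ' Δ'') : Hom Δ Δ'' where
  nom := ψ.nom ∘ χ.nom
  mod := ψ.mod ∘ χ.mod
  rs := ψ.rs ∘ χ.rs
  fs := ψ.smap ∘ χ.fs
  ff := ψ.fmap ∘ χ.ff
  rr := ψ.rr ∘ χ.rr
  fr := ψ.pmap ∘ χ.fr
  ff_ar f := by
    rw [← smap_comp_smap, ← Arity.map_map]
    exact (ψ.ar_fmap _).trans (congrArg (Arity.map ψ.smap) (χ.ff_ar f))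
  ff_cod f := by
    rw [← smap_comp_smap]
    exact (ψ.cod_fmap _).trans (congrArg ψ.smap (χ.ff_cod f))
  rr_ar p := by
    rw [← Arity.map_map]
    exact (ψ.rr_ar _).trans (congrArg (Arity.map ψ.rs) (χ.rr_ar p))
  fr_ar p := by
    rw [← smap_comp_smap, ← Arity.map_map]
    exact (ψ.relAr_pmap _).trans (congrArg (Arity.map ψ.smap) (χ.fr_ar p))
  rf := ψ.rf ∘ χ.rf
  rf_ar f := by
    rw [← Arity.map_map]
    exact (ψ.rf_ar _).trans (congrArg (Arity.map ψ.rs) (χ.rf_ar f))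
  rf_cod f := (ψ.rf_cod _).trans (congrArg ψ.rs (χ.rf_cod f))

end Hom

/-! ## Actions, hybrid terms, sentences -/

/-- Structured actions over a set of modalities. -/
inductive Action (P : Type u) : Type u
  | atom (a : P) : Action P
  | seq (a b : Action P) : Action P
  | union (a b : Action P) : Action P
  | star (a : Action P) : Action P

namespace Action

def map {P P' : Type u} (g : P → P') : Action P → Action P'
  | atom a => atom (g a)
  | seq a b => seq (a.map g) (b.map g)
  | union a b => union (a.map g) (b.map g)
  | star a => star (a.map g)

/-- `powSucc a n` is the `(n + 1)`-fold sequential composition of `a`. -/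
def powSucc {P : Type u} (a : Action P) : ℕ → Action P
  | 0 => a
  | n + 1 => seq a (a.powSucc n)

/-- The accessibility relation denoted by an action. -/
def interp {P : Type u} {W : Type u} (R : P → W → W → Prop) : Action P → W → W → Prop
  | atom a => R a
  | seq a b => Relation.Comp (a.interp R) (b.interp R)
  | union a b => fun w v => a.interp R w v ∨ b.interp R w v
  | star a => Relation.ReflTransGen (a.interp R)

end Action

/-- Hybrid terms, indexed by their hybrid sort. `fapp none σ t` is `σ(t)`, and `fapp (some k) σ t`
is `(@ₖ σ)(t)`, for `σ` flexible; `@ₖ σ = σ` for rigid `σ`. -/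
inductive Term (Δ : Signature.{u}) : Δ.HSort → Type u
  | rapp (f : Δ.RFunc) (args : ∀ i, Term Δ (Sum.inl ((Δ.rar f).dom i))) :
      Term Δ (Sum.inl (Δ.rcod f))
  | fapp (l : Option Δ.Nom) (f : Δ.FFunc) (args : ∀ i, Term Δ (Δ.hs l ((Δ.far f).dom i))) :
      Term Δ (Δ.hs l (Δ.fcod f))

/-- Sentences. `retr` is retrieve, `or γ` is the disjunction of a finite family of sentences. -/
inductive Sen : Signature.{u} → Type (u + 1)
  | nom {Δ : Signature.{u}} (k : Δ.Nom) : Sen Δ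
  | eq {Δ : Signature.{u}} {h : Δ.HSort} (t₁ t₂ : Term Δ h) : Sen Δ
  | rrel {Δ : Signature.{u}} (p : Δ.RRel)
      (args : ∀ i, Term Δ (Sum.inl ((Δ.rrar p).dom i))) : Sen Δ
  | frel {Δ : Signature.{u}} (l : Option Δ.Nom) (p : Δ.FRel)
      (args : ∀ i, Term Δ (Δ.hs l ((Δ.frar p).dom i))) : Sen Δ
  | retr {Δ : Signature.{u}} (k : Δ.Nom) (γ : Sen Δ) : Sen Δ
  | neg {Δ : Signature.{u}} (γ : Sen Δ) : Sen Δ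
  | or {Δ : Signature.{u}} {n : ℕ} (γ : Fin n → Sen Δ) : Sen Δ
  | store {Δ : Signature.{u}} (γ : Sen (Δ.extv (Vars.nominal Δ))) : Sen Δ
  | ex {Δ : Signature.{u}} (X : Vars Δ) (γ : Sen (Δ.extv X)) : Sen Δ
  | poss {Δ : Signature.{u}} (a : Action Δ.Mod) (γ : Sen Δ) : Sen Δ

/-- Universal quantification. -/
def Sen.all {Δ : Signature.{u}} (X : Vars Δ) (γ : Sen (Δ.extv X)) : Sen Δ :=
  Sen.neg (Sen.ex X (Sen.neg γ))

namespace Term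

variable {Δ : Signature.{u}}

/-- The rigid terms: those built from rigid symbols and symbols of the form `@ₖ σ`. -/
def IsRigid : {h : Δ.HSort} → Term Δ h → Prop
  | _, rapp _ args => ∀ i, (args i).IsRigid
  | _, fapp l _ args => l.isSome ∧ ∀ i, (args i).IsRigid

/-- Application of an arbitrary function symbol of arity `a` and sort `s` at the location `l`. -/
def mk {a : Arity Δ.Srt} {s : Δ.Srt} (l : Option Δ.Nom) (g : Δ.Func)
    (ha : Δ.ar g = a) (hc : Δ.cod g = s) (args : ∀ i, Term Δ (Δ.hs l (a.dom i))) :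
    Term Δ (Δ.hs l s) :=
  match g, a, s, ha, hc, args with
  | Sum.inl f, _, _, rfl, rfl, args => rapp f args
  | Sum.inr f, _, _, rfl, rfl, args => fapp l f args

/-- Application of a rigid function symbol of arity `a` and sort `s`. -/
def mkRigid {a : Arity Δ.RSort} {s : Δ.RSort} (g : Δ.RFunc)
    (ha : Δ.rar g = a) (hc : Δ.rcod g = s) (args : ∀ i, Term Δ (Sum.inl (a.dom i))) :
    Term Δ (Sum.inl s) :=
  match a, s, ha, hc, args with
  | _, _, rfl, rfl, args => rapp g args

end Term

namespace Sen

variable {Δ : Signature.{u}}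

/-- The atom for an arbitrary relation symbol of arity `a` at the location `l`. -/
def mkRel {a : Arity Δ.Srt} (l : Option Δ.Nom) (p : Δ.Rel)
    (ha : Δ.relAr p = a) (args : ∀ i, Term Δ (Δ.hs l (a.dom i))) : Sen Δ :=
  match p, a, ha, args with
  | Sum.inl p, _, rfl, args => rrel p args
  | Sum.inr p, _, rfl, args => frel l p args

/-- The atom for a rigid relation symbol of arity `a`. -/
def mkRRel {a : Arity Δ.RSort} (p : Δ.RRel)
    (ha : Δ.rrar p = a) (args : ∀ i, Term Δ (Sum.inl (a.dom i))) : Sen Δ :=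
  match a, ha, args with
  | _, rfl, args => rrel p args

end Sen

/-! ## Translations of sentences along signature morphisms and substitutions -/

/-- What a rigid function symbol may be mapped to: a rigid function symbol, or, for a constant,
a term. -/
inductive RImage (Δ : Signature.{u}) (a : Arity Δ.RSort) (s : Δ.RSort) : Type u
  | sym (g : Δ.RFunc) (ha : Δ.rar g = a) (hc : Δ.rcod g = s) : RImage Δ a s
  | tm (ha : a.n = 0) (t : Term Δ (Sum.inl s)) : RImage Δ a s

/-- A common generalization of signature morphisms and substitutions: rigid constants may be
mapped to terms. -/
structure GHom (Δ Δ' : Signature.{u}) : Type u extends PreHom Δ Δ' where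
  rf : ∀ f : Δ.RFunc, RImage Δ' ((Δ.rar f).map rs) (rs (Δ.rcod f))

/-- Signature morphisms as generalized morphisms. -/
def Hom.toGHom {Δ Δ' : Signature.{u}} (χ : Hom Δ Δ') : GHom Δ Δ' where
  toPreHom := χ.toPreHom
  rf f := RImage.sym (χ.rf f) (χ.rf_ar f) (χ.rf_cod f)

def RImage.app {Δ : Signature.{u}} {a : Arity Δ.RSort} {s : Δ.RSort} (r : RImage Δ a s)
    (args : ∀ i, Term Δ (Sum.inl (a.dom i))) : Term Δ (Sum.inl s) :=
  match r with
  | sym g ha hc => Term.mkRigid g ha hc args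
  | tm _ t => t

namespace PreHom

variable {Δ Δ' : Signature.{u}} (χ : PreHom Δ Δ')

/-- The two hybrid sorts agree by cases on `s`. -/
def toHs {l : Option Δ.Nom} : {s : Δ.Srt} →
    Term Δ' (χ.hmap (Δ.hs l s)) → Term Δ' (Δ'.hs (l.map χ.nom) (χ.smap s))
  | Sum.inl _, t => t
  | Sum.inr _, t => t

/-- The two hybrid sorts agree by cases on `s`. -/
def ofHs {l : Option Δ.Nom} : {s : Δ.Srt} →
    Term Δ' (Δ'.hs (l.map χ.nom) (χ.smap s)) → Term Δ' (χ.hmap (Δ.hs l s))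
  | Sum.inl _, t => t
  | Sum.inr _, t => t

end PreHom

/-- Translation of hybrid terms. -/
def Term.trans {Δ Δ' : Signature.{u}} (χ : GHom Δ Δ') :
    {h : Δ.HSort} → Term Δ h → Term Δ' (χ.hmap h)
  | _, Term.rapp f args => (χ.rf f).app (fun i => (args i).trans χ)
  | _, Term.fapp l f args =>
      χ.ofHs (Term.mk (l.map χ.nom) (χ.ff f) (χ.ff_ar f) (χ.ff_cod f)
        (fun i => χ.toHs ((args i).trans χ)))

/-- The image of a rigid symbol, transported along `Δ ↪ Δ[C]`. -/
def RImage.weaken {Δ : Signature.{u}} (C : Consts Δ) {a : Arity Δ.RSort} {s : Δ.RSort} :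
    RImage Δ a s → RImage (Δ.ext C) a s
  | sym g ha hc => sym (Δ := Δ.ext C) (Sum.inl g) ha hc
  | tm ha t => tm (Δ := Δ.ext C) ha (t.trans (Hom.incl Δ C).toGHom)

/-- The extension `Δ[C] → Δ'[C']` of `χ : Δ → Δ'` given by a map of the new constants. -/
def GHom.ext {Δ Δ' : Signature.{u}} (χ : GHom Δ Δ') (C : Consts Δ) (C' : Consts Δ')
    (gN : C.N → C'.N) (gD : C.D → C'.D) (hD : ∀ d, C'.srt (gD d) = χ.rs (C.srt d)) :
    GHom (Δ.ext C) (Δ'.ext C') where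
  nom := Sum.map χ.nom gN
  mod := χ.mod
  rs := χ.rs
  fs := χ.fs
  ff f := Sum.map Sum.inl id (χ.ff f)
  rr := χ.rr
  fr := χ.fr
  ff_ar f := by
    refine Eq.trans ?_ (χ.ff_ar f)
    cases χ.ff f <;> rfl
  ff_cod f := by
    refine Eq.trans ?_ (χ.ff_cod f)
    cases χ.ff f <;> rfl
  rr_ar p := χ.rr_ar p
  fr_ar p := by
    refine Eq.trans ?_ (χ.fr_ar p)
    cases χ.fr p <;> rfl
  rf
    | Sum.inl f => (χ.rf f).weaken C'
    | Sum.inr d => RImage.sym (Δ := Δ'.ext C') (Sum.inr (gD d))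
        (Arity.map_nil χ.rs).symm (hD d)

/-- The canonical extension `Δ[X] → Δ'[χ(X)]` of `χ : Δ → Δ'`. -/
def GHom.extv {Δ Δ' : Signature.{u}} (χ : GHom Δ Δ') (X : Vars Δ) :
    GHom (Δ.extv X) (Δ'.extv (χ.mapVars X)) :=
  χ.ext X.toConsts (χ.mapVars X).toConsts id id (fun _ => rfl)

/-- The canonical extension `Δ[z] → Δ'[z]` of `χ : Δ → Δ'`, for a nominal variable `z`. -/
def GHom.extNominal {Δ Δ' : Signature.{u}} (χ : GHom Δ Δ') :
    GHom (Δ.extv (Vars.nominal Δ)) (Δ'.extv (Vars.nominal Δ')) :=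
  χ.ext (Vars.nominal Δ).toConsts (Vars.nominal Δ').toConsts id id (fun d => d.down.elim0)

/-- Translation of sentences. -/
def Sen.trans : {Δ Δ' : Signature.{u}} → GHom Δ Δ' → Sen Δ → Sen Δ'
  | _, _, χ, Sen.nom k => Sen.nom (χ.nom k)
  | _, _, χ, Sen.eq t₁ t₂ => Sen.eq (t₁.trans χ) (t₂.trans χ)
  | _, _, χ, Sen.rrel p args => Sen.mkRRel (χ.rr p) (χ.rr_ar p) (fun i => (args i).trans χ)
  | _, _, χ, Sen.frel l p args =>
      Sen.mkRel (l.map χ.nom) (χ.fr p) (χ.fr_ar p) (fun i => χ.toHs ((args i).trans χ))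
  | _, _, χ, Sen.retr k γ => Sen.retr (χ.nom k) (γ.trans χ)
  | _, _, χ, Sen.neg γ => Sen.neg (γ.trans χ)
  | _, _, χ, Sen.or γ => Sen.or (fun i => (γ i).trans χ)
  | _, _, χ, Sen.store γ => Sen.store (γ.trans χ.extNominal)
  | _, _, χ, Sen.ex X γ => Sen.ex (χ.mapVars X) (γ.trans (χ.extv X))
  | _, _, χ, Sen.poss a γ => Sen.poss (a.map χ.mod) (γ.trans χ)

/-! ## Kripke structures -/

/-- Kripke structures. The rigid symbols have the same interpretation in all worlds; so the
carrier sets of rigid sorts and the rigid function and relation symbols are interpreted once. -/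
structure Kripke (Δ : Signature.{u}) : Type (u + 1) where
  W : Type u
  nonemptyW : Nonempty W
  nom : Δ.Nom → W
  mod : Δ.Mod → W → W → Prop
  RC : Δ.RSort → Type u
  nonemptyRC : ∀ s, Nonempty (RC s)
  FC : W → Δ.FSort → Type u
  nonemptyFC : ∀ w s, Nonempty (FC w s)
  rf : ∀ f : Δ.RFunc, (∀ i, RC ((Δ.rar f).dom i)) → RC (Δ.rcod f)
  ff : ∀ (w : W) (f : Δ.FFunc), (∀ i, Sum.elim RC (FC w) ((Δ.far f).dom i)) →
    Sum.elim RC (FC w) (Δ.fcod f)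
  rr : ∀ p : Δ.RRel, (∀ i, RC ((Δ.rrar p).dom i)) → Prop
  fr : ∀ (w : W) (p : Δ.FRel), (∀ i, Sum.elim RC (FC w) ((Δ.frar p).dom i)) → Prop

namespace Kripke

variable {Δ : Signature.{u}} (M : Kripke Δ)

/-- The carrier set `M_{w,s}`. -/
abbrev Car (w : M.W) : Δ.Srt → Type u := Sum.elim M.RC (M.FC w)

/-- The world at which a location is evaluated from `w`. -/
def loc (w : M.W) : Option Δ.Nom → M.W
  | none => w
  | some k => M.nom k

/-- The set in which the hybrid terms of a given hybrid sort are interpreted at `w`. -/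
def Val (w : M.W) : Δ.HSort → Type u
  | Sum.inl s => M.RC s
  | Sum.inr (l, s) => M.FC (M.loc w l) s

/-- The two sets agree by cases on `s`. -/
def toCar {w : M.W} {l : Option Δ.Nom} : {s : Δ.Srt} → M.Val w (Δ.hs l s) → M.Car (M.loc w l) s
  | Sum.inl _, a => a
  | Sum.inr _, a => a

/-- The two sets agree by cases on `s`. -/
def ofCar {w : M.W} {l : Option Δ.Nom} : {s : Δ.Srt} → M.Car (M.loc w l) s → M.Val w (Δ.hs l s)
  | Sum.inl _, a => a
  | Sum.inr _, a => a

/-- Interpretations of new constants. -/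
structure Assignment (C : Consts Δ) : Type u where
  nom : C.N → M.W
  con : ∀ d : C.D, M.RC (C.srt d)

/-- The expansion of `M` to `Δ[C]` given by an interpretation of the new constants. Every expansion
of `M` to `Δ[C]` is of this form. -/
def expand {C : Consts Δ} (ν : M.Assignment C) : Kripke (Δ.ext C) where
  W := M.W
  nonemptyW := M.nonemptyW
  nom := Sum.elim M.nom ν.nom
  mod := M.mod
  RC := M.RC
  nonemptyRC := M.nonemptyRC
  FC := M.FC
  nonemptyFC := M.nonemptyFC
  rf
    | Sum.inl f, args => M.rf f args
    | Sum.inr d, _ => ν.con d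
  ff := M.ff
  rr := M.rr
  fr := M.fr

end Kripke

/-- The interpretation of a hybrid term at a world. -/
def Term.eval {Δ : Signature.{u}} (M : Kripke Δ) (w : M.W) :
    {h : Δ.HSort} → Term Δ h → M.Val w h
  | _, Term.rapp f args => M.rf f (fun i => (args i).eval M w)
  | _, Term.fapp l f args =>
      M.ofCar (M.ff (M.loc w l) f (fun i => M.toCar ((args i).eval M w)))

/-- Local satisfaction `M ⊨ʷ γ`. -/
def Sen.Sat : {Δ : Signature.{u}} → Sen Δ → (M : Kripke Δ) → M.W → Prop
  | _, Sen.nom k, M, w => M.nom k = w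
  | _, Sen.eq t₁ t₂, M, w => t₁.eval M w = t₂.eval M w
  | _, Sen.rrel p args, M, w => M.rr p (fun i => (args i).eval M w)
  | _, Sen.frel l p args, M, w =>
      M.fr (M.loc w l) p (fun i => M.toCar ((args i).eval M w))
  | _, Sen.retr k γ, M, _ => γ.Sat M (M.nom k)
  | _, Sen.neg γ, M, w => ¬ γ.Sat M w
  | _, Sen.or γ, M, w => ∃ i, (γ i).Sat M w
  | Δ, Sen.store γ, M, w =>
      γ.Sat (M.expand (C := (Vars.nominal Δ).toConsts) ⟨fun _ => w, fun d => d.down.elim0⟩) w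
  | _, Sen.ex X γ, M, w => ∃ ν : M.Assignment X.toConsts, γ.Sat (M.expand ν) w
  | _, Sen.poss a γ, M, w => ∃ v, a.interp M.mod w v ∧ γ.Sat M v

/-- Local equivalence of sentences: they are satisfied at the same worlds of all structures. -/
def Sen.Equiv {Δ : Signature.{u}} (γ γ' : Sen Δ) : Prop :=
  ∀ (M : Kripke Δ) (w : M.W), γ.Sat M w ↔ γ'.Sat M w

/-- Global satisfaction of a set of sentences. -/
def Kripke.Models {Δ : Signature.{u}} (M : Kripke Δ) (T : Set (Sen Δ)) : Prop :=
  ∀ γ ∈ T, ∀ w, γ.Sat M w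

/-- A set of sentences is satisfiable. -/
def Satisfiable {Δ : Signature.{u}} (T : Set (Sen Δ)) : Prop :=
  ∃ M : Kripke Δ, M.Models T

/-- Global semantic consequence. -/
def Entails {Δ : Signature.{u}} (T Γ : Set (Sen Δ)) : Prop :=
  ∀ M : Kripke Δ, M.Models T → M.Models Γ

/-! ## Substitutions -/

/-- The signatures obtained from `Δ` by repeatedly adding sets of new nominals and rigid constants,
i.e. the signatures `Δ[C₁]⋯[Cₙ] = Δ[C₁ ∪ ⋯ ∪ Cₙ]`. -/
inductive Extension (Δ : Signature.{u}) : Signature.{u} → Type (u + 1)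
  | refl : Extension Δ Δ
  | step {Δ' : Signature.{u}} (e : Extension Δ Δ') (C : Consts Δ') : Extension Δ (Δ'.ext C)

/-- The inclusion of `Δ` in an extension by constants. -/
def Extension.incl {Δ : Signature.{u}} : {Δ' : Signature.{u}} → Extension Δ Δ' → Hom Δ Δ'
  | _, refl => Hom.id Δ
  | _, step e C => e.incl.comp (Hom.incl _ C)

/-- Substitutions over `Δ` of the constants in `C` by nominals and rigid terms of an extension `Δ'`
of `Δ` by constants, with inclusion `ι`. -/
structure Subst {Δ Δ' : Signature.{u}} (ι : Hom Δ Δ') (C : Consts Δ) : Type u where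
  nom : C.N → Δ'.Nom
  con : ∀ d : C.D, Term Δ' (Sum.inl (ι.rs (C.srt d)))
  rigid : ∀ d, (con d).IsRigid

/-- The generalized morphism `Δ[C] → Δ'` which extends `ι : Δ → Δ'` by a substitution. -/
def Subst.toGHom {Δ Δ' : Signature.{u}} {ι : Hom Δ Δ'} {C : Consts Δ} (θ : Subst ι C) :
    GHom (Δ.ext C) Δ' where
  nom := Sum.elim ι.nom θ.nom
  mod := ι.mod
  rs := ι.rs
  fs := ι.fs
  ff := ι.ff
  rr := ι.rr
  fr := ι.fr
  ff_ar := ι.ff_ar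
  ff_cod := ι.ff_cod
  rr_ar := ι.rr_ar
  fr_ar := ι.fr_ar
  rf
    | Sum.inl f => RImage.sym (ι.rf f) (ι.rf_ar f) (ι.rf_cod f)
    | Sum.inr d => RImage.tm rfl (θ.con d)

/-- The application `θ(γ)` of a substitution to a sentence. -/
def Sen.subst {Δ Δ' : Signature.{u}} {ι : Hom Δ Δ'} {C : Consts Δ} (θ : Subst ι C)
    (γ : Sen (Δ.ext C)) : Sen Δ' := γ.trans θ.toGHom

/-- Translation of sentences along signature morphisms. -/
def Sen.map {Δ Δ' : Signature.{u}} (χ : Hom Δ Δ') (γ : Sen Δ) : Sen Δ' := γ.trans χ.toGHom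

/-- The substitution of a nominal for a single nominal variable. -/
def Subst.ofNominal {Δ : Signature.{u}} (k : Δ.Nom) :
    Subst (Hom.id Δ) (Vars.nominal Δ).toConsts where
  nom _ := k
  con d := d.down.elim0
  rigid d := d.down.elim0

/-- The substitution over `Δ` of a rigid term over `Δ[C]` for a single variable of rigid sort. -/
def Subst.ofTerm {Δ : Signature.{u}} (C : Consts Δ) {s : Δ.RSort}
    (t : Term (Δ.ext C) (Sum.inl s)) (ht : t.IsRigid) :
    Subst (Hom.incl Δ C) (Vars.single s).toConsts where
  nom x := x.down.elim0
  con _ := t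
  rigid _ := ht

/-! ## Fragments -/

/-- A fragment of the logic: a subcategory of the category of signatures and a subfunctor of the
sentence functor, closed under adding constants, under substitutions, and under subsentences. -/
structure Fragment : Type (u + 2) where
  sig : Set Signature.{u}
  mor : ∀ {Δ Δ' : Signature.{u}}, Set (Hom Δ Δ')
  sen : ∀ Δ : Signature.{u}, Set (Sen Δ)
  id_mem : ∀ Δ ∈ sig, Hom.id Δ ∈ mor
  comp_mem : ∀ {Δ Δ' Δ'' : Signature.{u}} (χ : Hom Δ Δ') (ψ : Hom Δ' Δ''),
    Δ ∈ sig → Δ' ∈ sig → Δ'' ∈ sig → χ ∈ mor → ψ ∈ mor → χ.comp ψ ∈ mor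
  map_mem : ∀ {Δ Δ' : Signature.{u}} (χ : Hom Δ Δ'), Δ ∈ sig → Δ' ∈ sig → χ ∈ mor →
    ∀ γ ∈ sen Δ, γ.map χ ∈ sen Δ'
  ext_sig : ∀ Δ ∈ sig, ∀ C : Consts Δ, Δ.ext C ∈ sig
  ext_mor : ∀ Δ ∈ sig, ∀ C : Consts Δ, Hom.incl Δ C ∈ mor
  subst_mem : ∀ {Δ Δ' : Signature.{u}} (e : Extension Δ Δ') (C : Consts Δ)
    (θ : Subst e.incl C), Δ ∈ sig → ∀ γ ∈ sen (Δ.ext C), γ.subst θ ∈ sen Δ'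
  seq_mem : ∀ Δ ∈ sig, ∀ (a b : Action Δ.Mod) (γ : Sen Δ),
    Sen.poss (Action.seq a b) γ ∈ sen Δ → Sen.poss a γ ∈ sen Δ ∧ Sen.poss b γ ∈ sen Δ
  union_mem : ∀ Δ ∈ sig, ∀ (a b : Action Δ.Mod) (γ : Sen Δ),
    Sen.poss (Action.union a b) γ ∈ sen Δ → Sen.poss a γ ∈ sen Δ ∧ Sen.poss b γ ∈ sen Δ
  star_mem : ∀ Δ ∈ sig, ∀ (a : Action Δ.Mod) (γ : Sen Δ),
    Sen.poss (Action.star a) γ ∈ sen Δ → ∃ n, Sen.poss (a.powSucc n) γ ∈ sen Δ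
  poss_mem : ∀ Δ ∈ sig, ∀ (a : Action Δ.Mod) (γ : Sen Δ), Sen.poss a γ ∈ sen Δ → γ ∈ sen Δ
  neg_mem : ∀ Δ ∈ sig, ∀ γ : Sen Δ, Sen.neg γ ∈ sen Δ → γ ∈ sen Δ
  or_mem : ∀ Δ ∈ sig, ∀ {n : ℕ} (γ : Fin n → Sen Δ), Sen.or γ ∈ sen Δ → ∀ i, γ i ∈ sen Δ
  retr_mem : ∀ Δ ∈ sig, ∀ (k : Δ.Nom) (γ : Sen Δ), Sen.retr k γ ∈ sen Δ → γ ∈ sen Δ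
  store_mem : ∀ Δ ∈ sig, ∀ γ : Sen (Δ.extv (Vars.nominal Δ)),
    Sen.store γ ∈ sen Δ → γ ∈ sen (Δ.extv (Vars.nominal Δ))
  ex_mem : ∀ Δ ∈ sig, ∀ (X : Vars Δ) (γ : Sen (Δ.extv X)),
    Sen.ex X γ ∈ sen Δ → γ ∈ sen (Δ.extv X)

namespace Fragment

variable (L : Fragment.{u})

/-- The sentence `γ` is expressible in `L`: some `L`-sentence is locally equivalent to it. -/
def Expresses {Δ : Signature.{u}} (γ : Sen Δ) : Prop := ∃ φ ∈ L.sen Δ, φ.Equiv γ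

/-- Semantic closure under equality (of nominals with the current world, and of hybrid terms). -/
def ClosedEq : Prop := ∀ Δ ∈ L.sig,
  (∀ k : Δ.Nom, L.Expresses (Sen.nom k)) ∧
  (∀ (h : Δ.HSort) (t₁ t₂ : Term Δ h), L.Expresses (Sen.eq t₁ t₂))

/-- Semantic closure under negation. -/
def ClosedNeg : Prop := ∀ Δ ∈ L.sig, ∀ γ ∈ L.sen Δ, L.Expresses (Sen.neg γ)

/-- Semantic closure under retrieve. -/
def ClosedRetr : Prop := ∀ Δ ∈ L.sig, ∀ γ ∈ L.sen Δ, ∀ k, L.Expresses (Sen.retr k γ)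

/-- Semantic closure under (finite) disjunctions. -/
def ClosedOr : Prop := ∀ Δ ∈ L.sig, ∀ (n : ℕ) (γ : Fin n → Sen Δ),
  (∀ i, γ i ∈ L.sen Δ) → L.Expresses (Sen.or γ)

/-- Semantic closure under quantifiers. -/
def ClosedEx : Prop := ∀ Δ ∈ L.sig, ∀ (X : Vars Δ), ∀ γ ∈ L.sen (Δ.extv X),
  L.Expresses (Sen.ex X γ)

/-! ### The omitting types property -/

/-- A Kripke structure realizes a type with free variables `X`. -/
def _root_.HDFOLR.Kripke.Realizes {Δ : Signature.{u}} (M : Kripke Δ) (X : Vars Δ)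
    (Γ : Set (Sen (Δ.extv X))) : Prop :=
  ∃ ν : M.Assignment X.toConsts, (M.expand ν).Models Γ

/-- The theory `T` over `Δ` `α`-realizes the type `Γ` with free variables `X`: there are fewer than
`α` new constants `C`, a substitution `θ : X → C` over `Δ` and a set `p` of fewer than `α`
sentences over `Δ[C]` such that `T ∪ p` is satisfiable and `T ∪ p ⊨ θ(Γ)`. -/
def AlphaRealizes (α : Cardinal.{u}) {Δ : Signature.{u}} (T : Set (Sen Δ)) (X : Vars Δ)
    (Γ : Set (Sen (Δ.extv X))) : Prop :=
  ∃ (C : Consts Δ) (θ : Subst (Hom.incl Δ C) X.toConsts) (p : Set (Sen (Δ.ext C))),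
    Cardinal.mk C.N < α ∧ Cardinal.mk C.D < α ∧
    p ⊆ L.sen (Δ.ext C) ∧ Cardinal.mk p < Cardinal.lift.{u + 1} α ∧
    Satisfiable (Sen.map (Hom.incl Δ C) '' T ∪ p) ∧
    Entails (Sen.map (Hom.incl Δ C) '' T ∪ p) (Sen.subst θ '' Γ)

/-- The `α`-omitting types property. -/
def AlphaOTP (α : Cardinal.{u}) : Prop :=
  ∀ Δ ∈ L.sig, Δ.power ≤ α →
  ∀ T ⊆ L.sen Δ, Satisfiable T →
  ∀ (I : Type u), Cardinal.mk I = α →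
  ∀ (X : I → Vars Δ) (Γ : ∀ i, Set (Sen (Δ.extv (X i)))),
    (∀ i, Γ i ⊆ L.sen (Δ.extv (X i))) →
    (∀ i, ¬ L.AlphaRealizes α T (X i) (Γ i)) →
    ∃ M : Kripke Δ, M.Models T ∧ ∀ i, ¬ M.Realizes (X i) (Γ i)

/-- The omitting types property: `α`-OTP whenever `α` is at least the power of a signature. -/
def OTP : Prop := ∀ Δ ∈ L.sig, ∀ α : Cardinal.{u}, Δ.power ≤ α → L.AlphaOTP α

/-- The omitting types property includes the `ℵ₀`-omitting types property as soon as there is a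
countable signature. -/
theorem OTP.alphaOTP_aleph0 {L : Fragment.{u}} (h : L.OTP) {Δ : Signature.{u}} (hΔ : Δ ∈ L.sig)
    (hc : Δ.power ≤ Cardinal.aleph0) : L.AlphaOTP Cardinal.aleph0 := h Δ hΔ _ hc

/-! ### Entailment relations -/

/-- The signatures of `L`. -/
abbrev Sig : Type (u + 1) := {Δ : Signature.{u} // Δ ∈ L.sig}

/-- The signature morphisms of `L`. -/
abbrev Mor (Δ Δ' : L.Sig) : Type u := {χ : Hom Δ.1 Δ'.1 // χ ∈ L.mor}

/-- The sentences of `L` over `Δ`. -/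
abbrev Sentence (Δ : Signature.{u}) : Type (u + 1) := {γ : Sen Δ // γ ∈ L.sen Δ}

/-- Translation of `L`-sentences. -/
def mapSen {L : Fragment.{u}} {Δ Δ' : L.Sig} (χ : L.Mor Δ Δ') (γ : L.Sentence Δ.1) :
    L.Sentence Δ'.1 :=
  ⟨γ.1.map χ.1, L.map_mem χ.1 Δ.2 Δ'.2 χ.2 γ.1 γ.2⟩

/-- Entailment relations for `L`. -/
structure EntailmentRelation : Type (u + 1) where
  rel : ∀ Δ : L.Sig, Set (L.Sentence Δ.1) → Set (L.Sentence Δ.1) → Prop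
  mono : ∀ (Δ : L.Sig) (Φ₁ Φ₂ : Set (L.Sentence Δ.1)), Φ₁ ⊆ Φ₂ → rel Δ Φ₂ Φ₁
  trans : ∀ (Δ : L.Sig) (Φ₁ Φ₂ Φ₃ : Set (L.Sentence Δ.1)),
    rel Δ Φ₁ Φ₂ → rel Δ Φ₂ Φ₃ → rel Δ Φ₁ Φ₃
  union : ∀ (Δ : L.Sig) (Φ₁ Φ₂ : Set (L.Sentence Δ.1)),
    (∀ φ ∈ Φ₂, rel Δ Φ₁ {φ}) → rel Δ Φ₁ Φ₂
  translation : ∀ (Δ Δ' : L.Sig) (χ : L.Mor Δ Δ') (Φ₁ Φ₂ : Set (L.Sentence Δ.1)),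
    rel Δ Φ₁ Φ₂ → rel Δ' (mapSen χ '' Φ₁) (mapSen χ '' Φ₂)

/-- Completeness of an entailment relation for `L`: semantic consequences are derivable. -/
def EntailmentRelation.Complete {L : Fragment.{u}} (E : L.EntailmentRelation) : Prop :=
  ∀ (Δ : L.Sig) (Φ Ψ : Set (L.Sentence Δ.1)),
    Entails (Subtype.val '' Φ) (Subtype.val '' Ψ) → E.rel Δ Φ Ψ

end Fragment

/-! ## The constructor-based logic -/

section Constructors

variable {Δ : Signature.{u}} (c : Set Δ.RFunc)

/-- A rigid sort is constrained if it has a constructor; otherwise it is loose. -/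
def Constrained (s : Δ.RSort) : Prop := ∃ f ∈ c, Δ.rcod f = s

/-- Countably infinitely many variables for each loose sort. -/
def looseVars : Consts Δ where
  N := PEmpty.{u + 1}
  D := {s : Δ.RSort // ¬ Constrained c s} × ℕ
  srt d := d.1.1

/-- Terms over `Δ[Y]` built from constructors and the rigid constants in `Y`. -/
inductive IsConstructorTerm {Y : Consts Δ} : {h : (Δ.ext Y).HSort} → Term (Δ.ext Y) h → Prop
  | var (d : Y.D) (args) :
      IsConstructorTerm (Term.rapp (Δ := Δ.ext Y) (Sum.inr d) args)
  | app (f : Δ.RFunc) (hf : f ∈ c) (args) (h : ∀ i, IsConstructorTerm (args i)) :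
      IsConstructorTerm (Term.rapp (Δ := Δ.ext Y) (Sum.inl f) args)

variable {c} in
theorem IsConstructorTerm.isRigid {Y : Consts Δ} {h : (Δ.ext Y).HSort} {t : Term (Δ.ext Y) h}
    (ht : IsConstructorTerm c t) : t.IsRigid := by
  induction ht with
  | var d args => intro i; exact i.elim0
  | app f hf args _ ih => exact ih

/-- The rigid symbol `f` occurs in a term. -/
def Term.Occurs (f : Δ.RFunc) : {h : Δ.HSort} → Term Δ h → Prop
  | _, Term.rapp g args => g = f ∨ ∃ i, (args i).Occurs f
  | _, Term.fapp _ _ args => ∃ i, (args i).Occurs f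

/-- `Z` is the set of variables occurring in the constructor term `t`, and all of them are
loose. -/
structure IsLooseConstructorTerm (Z : Vars Δ) {s : Δ.RSort}
    (t : Term (Δ.extv Z) (Sum.inl s)) : Prop where
  no_nominals : Z.n = 0
  loose : ∀ i, ¬ Constrained c (Z.srt i)
  constructor_term : IsConstructorTerm c (Y := Z.toConsts) t
  occurs : ∀ d : Z.toConsts.D, Term.Occurs (Δ := Δ.extv Z) (Sum.inr d) t

/-- Constructor-based Kripke structures: every world is the denotation of a nominal, and every
element of a rigid sort is the denotation of a term formed with constructors and loose variables,
for some interpretation of the loose variables. -/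
def Kripke.ConstructorBased (M : Kripke Δ) : Prop :=
  (∀ w : M.W, ∃ k : Δ.Nom, w = M.nom k) ∧
  ∀ (s : Δ.RSort) (w : M.W) (m : M.RC s),
    ∃ (ν : M.Assignment (looseVars c)) (t : Term (Δ.ext (looseVars c)) (Sum.inl s)),
      IsConstructorTerm c t ∧ m = t.eval (M.expand ν) w

end Constructors

namespace Fragment

variable (L : Fragment.{u})

/-- The signatures of the constructor-based logic: signatures of `L` with a set of constructors
among their rigid function symbols. -/
structure CSig : Type (u + 1) where
  base : L.Sig
  cons : Set base.1.RFunc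

/-- Semantic consequence in the constructor-based logic. -/
def CEntails {L : Fragment.{u}} (Ξ : L.CSig) (Φ Ψ : Set (L.Sentence Ξ.base.1)) : Prop :=
  ∀ M : Kripke Ξ.base.1, M.ConstructorBased Ξ.cons →
    M.Models (Subtype.val '' Φ) → M.Models (Subtype.val '' Ψ)

/-- Morphisms of signatures with constructors: morphisms of `L` that preserve constructors. -/
abbrev CMor (Ξ Ξ' : L.CSig) : Type u :=
  {χ : L.Mor Ξ.base Ξ'.base // ∀ f ∈ Ξ.cons, χ.1.rf f ∈ Ξ'.cons}

/-- The constructor-based entailment relation generated by an entailment relation `E` for `L`: the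
least entailment relation, with translations along the morphisms in `𝓜`, which is closed under
the rules R0, R1 and R2. In R1 and R2 the sentences `@ₖ φ(k')`, `∀ x φ(x)`, `@ₖ ∀ Y_t ψ(t)`, `∀ y ψ(y)`
are represented by `L`-sentences which are locally equivalent to them. -/
inductive CDerives {L : Fragment.{u}} (E : L.EntailmentRelation)
    (𝓜 : ∀ Ξ Ξ' : L.CSig, Set (L.CMor Ξ Ξ')) :
    ∀ Ξ : L.CSig, Set (L.Sentence Ξ.base.1) → Set (L.Sentence Ξ.base.1) → Prop
  | mono (Ξ : L.CSig) (Φ₁ Φ₂ : Set (L.Sentence Ξ.base.1)) :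
      Φ₁ ⊆ Φ₂ → CDerives E 𝓜 Ξ Φ₂ Φ₁
  | trans (Ξ : L.CSig) (Φ₁ Φ₂ Φ₃ : Set (L.Sentence Ξ.base.1)) :
      CDerives E 𝓜 Ξ Φ₁ Φ₂ → CDerives E 𝓜 Ξ Φ₂ Φ₃ → CDerives E 𝓜 Ξ Φ₁ Φ₃
  | union (Ξ : L.CSig) (Φ₁ Φ₂ : Set (L.Sentence Ξ.base.1)) :
      (∀ φ ∈ Φ₂, CDerives E 𝓜 Ξ Φ₁ {φ}) → CDerives E 𝓜 Ξ Φ₁ Φ₂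
  | translation (Ξ Ξ' : L.CSig) (χ : L.CMor Ξ Ξ') (hχ : χ ∈ 𝓜 Ξ Ξ')
      (Φ₁ Φ₂ : Set (L.Sentence Ξ.base.1)) :
      CDerives E 𝓜 Ξ Φ₁ Φ₂ → CDerives E 𝓜 Ξ' (mapSen χ.1 '' Φ₁) (mapSen χ.1 '' Φ₂)
  | r0 (Ξ : L.CSig) (Φ : Set (L.Sentence Ξ.base.1)) (φ : L.Sentence Ξ.base.1) :
      E.rel Ξ.base Φ {φ} → CDerives E 𝓜 Ξ Φ {φ}
  | r1 (Ξ : L.CSig) (Φ : Set (L.Sentence Ξ.base.1))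
      (φ : L.Sentence (Ξ.base.1.extv (Vars.nominal Ξ.base.1)))
      (σ : Ξ.base.1.Nom → Ξ.base.1.Nom → L.Sentence Ξ.base.1) (ρ : L.Sentence Ξ.base.1)
      (hσ : ∀ k₁ k₂, (σ k₁ k₂).1.Equiv (Sen.retr k₁ (φ.1.subst (Subst.ofNominal k₂))))
      (hρ : ρ.1.Equiv (Sen.all (Vars.nominal Ξ.base.1) φ.1)) :
      (∀ k₁ k₂, CDerives E 𝓜 Ξ Φ {σ k₁ k₂}) → CDerives E 𝓜 Ξ Φ {ρ}
  | r2 (Ξ : L.CSig) (Φ : Set (L.Sentence Ξ.base.1)) (s : Ξ.base.1.RSort)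
      (hs : Constrained Ξ.cons s)
      (ψ : L.Sentence (Ξ.base.1.extv (Vars.single s)))
      (σ : ∀ (_ : Ξ.base.1.Nom) (Z : Vars Ξ.base.1) (t : Term (Ξ.base.1.extv Z) (Sum.inl s)),
        IsLooseConstructorTerm Ξ.cons Z t → L.Sentence Ξ.base.1)
      (ρ : L.Sentence Ξ.base.1)
      (hσ : ∀ k Z t ht, (σ k Z t ht).1.Equiv
        (Sen.retr k (Sen.all Z
          (ψ.1.subst (Subst.ofTerm Z.toConsts t ht.constructor_term.isRigid)))))
      (hρ : ρ.1.Equiv (Sen.all (Vars.single s) ψ.1)) :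
      (∀ k Z t ht, CDerives E 𝓜 Ξ Φ {σ k Z t ht}) → CDerives E 𝓜 Ξ Φ {ρ}

end Fragment

end HDFOLR

/-!
Completeness is proved by applying the omitting types property to a theory of derivable sentences.
Suppose that `ψ` is not derivable from `Φ`, let `S` be the set of all sentences derivable from
`Φ`, and let `χ` say that `ψ` fails at some world. As the given entailment relation is complete,
`S` is closed under semantic consequence (`mem_derivable_of_entails`); hence `S ∪ {χ}` is
satisfiable. A model of it which is constructor-based refutes `Φ ⊨ᶜ ψ`.

A structure is constructor-based as soon as it omits countably many types: the type of a world `x`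
different from every nominal, and for each constrained sort the type of an element `y` different
from every value of a constructor term (`Kripke.constructorBased_of_omits`). Both have the same
shape: given a family `F` of substitutions `θ'` of the variables `x` over signatures `Δ[C']` with
`C'` finite, the type consists of the sentences `∀ C' (x ≠ θ'(x))`.

The main step is `not_alphaRealizes_typeOfSubsts`: `S ∪ {χ}` locally omits such a type if the
models of `S` obey the infinitary rule which infers `∀ x φ(x)` from the instances of `φ` under
`F`. Indeed, let `q` be a finite set of sentences over `Δ[C]` containing `χ`, such that `S ∪ q`
entails the type at `θ(x)`, and let `φ(x)` be the formula `∀ C (x = θ(x) → ¬ □q)`, where `□q` says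
that `q` is true at all worlds. A counterexample to an instance of `φ` under `θ'` would be a model
of `S ∪ q` in which `θ(x)` is a value of `θ'`. So all instances hold, `∀ x φ(x)` follows by the
rule, and `S ∪ q` has no model. For the family of nominals the rule is R1, for the family of
constructor terms it is R2. The formula `φ` has to be expressed in the fragment
(`exists_forall_value_ne`); for this `C` is exchanged for a set of variables over `Δ[x]` by a
substitution (`exists_vars_of_finite`).

The semantic evaluation of all these sentences rests on the satisfaction condition
(`Sen.sat_trans`) for generalized morphisms, which cover both signature morphisms and
substitutions. Reducts along them are defined for a chosen world, at which the substituted terms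
are evaluated; this choice is immaterial for rigid terms.
-/

namespace HDFOLR

/-! ### Interpretation of symbols with prescribed arity -/

namespace Kripke

variable {Δ : Signature.{u}} (M : Kripke Δ)

/-- The interpretation of a rigid function symbol, seen at an arity `a` and a sort `s` which are
only propositionally those of the symbol. -/
def rfAt {a : Arity Δ.RSort} {s : Δ.RSort} (g : Δ.RFunc) (ha : Δ.rar g = a) (hc : Δ.rcod g = s)
    (args : ∀ i, M.RC (a.dom i)) : M.RC s :=
  match a, s, ha, hc, args with
  | _, _, rfl, rfl, args => M.rf g args

/-- The interpretation at `w` of an arbitrary function symbol of arity `a` and sort `s`. -/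
def ffAt (w : M.W) {a : Arity Δ.Srt} {s : Δ.Srt} (g : Δ.Func) (ha : Δ.ar g = a)
    (hc : Δ.cod g = s) (args : ∀ i, M.Car w (a.dom i)) : M.Car w s :=
  match g, a, s, ha, hc, args with
  | Sum.inl f, _, _, rfl, rfl, args => M.rf f args
  | Sum.inr f, _, _, rfl, rfl, args => M.ff w f args

/-- The interpretation of a rigid relation symbol of arity `a`. -/
def rrAt {a : Arity Δ.RSort} (p : Δ.RRel) (ha : Δ.rrar p = a)
    (args : ∀ i, M.RC (a.dom i)) : Prop :=
  match a, ha, args with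
  | _, rfl, args => M.rr p args

/-- The interpretation at `w` of an arbitrary relation symbol of arity `a`. -/
def frAt (w : M.W) {a : Arity Δ.Srt} (p : Δ.Rel) (ha : Δ.relAr p = a)
    (args : ∀ i, M.Car w (a.dom i)) : Prop :=
  match p, a, ha, args with
  | Sum.inl p, _, rfl, args => M.rr p args
  | Sum.inr p, _, rfl, args => M.fr w p args

end Kripke

section Eval

variable {Δ : Signature.{u}} (M : Kripke Δ)

theorem Term.eval_mkRigid (w : M.W) {a : Arity Δ.RSort} {s : Δ.RSort} (g : Δ.RFunc)
    (ha : Δ.rar g = a) (hc : Δ.rcod g = s) (args : ∀ i, Term Δ (Sum.inl (a.dom i))) :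
    (Term.mkRigid g ha hc args).eval M w = M.rfAt g ha hc (fun i => (args i).eval M w) := by
  subst ha hc; rfl

theorem Term.eval_mk (w : M.W) {a : Arity Δ.Srt} {s : Δ.Srt} (l : Option Δ.Nom) (g : Δ.Func)
    (ha : Δ.ar g = a) (hc : Δ.cod g = s) (args : ∀ i, Term Δ (Δ.hs l (a.dom i))) :
    (Term.mk l g ha hc args).eval M w =
      M.ofCar (M.ffAt (M.loc w l) g ha hc (fun i => M.toCar ((args i).eval M w))) := by
  subst ha hc
  cases g <;> rfl

theorem Sen.sat_mkRRel (w : M.W) {a : Arity Δ.RSort} (p : Δ.RRel)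
    (ha : Δ.rrar p = a) (args : ∀ i, Term Δ (Sum.inl (a.dom i))) :
    (Sen.mkRRel p ha args).Sat M w ↔ M.rrAt p ha (fun i => (args i).eval M w) := by
  subst ha; rfl

theorem Sen.sat_mkRel (w : M.W) {a : Arity Δ.Srt} (l : Option Δ.Nom) (p : Δ.Rel)
    (ha : Δ.relAr p = a) (args : ∀ i, Term Δ (Δ.hs l (a.dom i))) :
    (Sen.mkRel l p ha args).Sat M w ↔
      M.frAt (M.loc w l) p ha (fun i => M.toCar ((args i).eval M w)) := by
  subst ha
  cases p <;> rfl

/-- The value of a rigid term does not depend on the world. For flexible sorts the two values lie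
in sets which agree only propositionally. -/
theorem Term.IsRigid.eval_heq {h : Δ.HSort} {t : Term Δ h} (ht : t.IsRigid) (w w' : M.W) :
    HEq (t.eval M w) (t.eval M w') := by
  induction t with
  | rapp f args ih =>
    have : (fun i => (args i).eval M w) = fun i => (args i).eval M w' :=
      funext fun i => eq_of_heq (ih i (ht i))
    exact heq_of_eq (congrArg (M.rf f) this)
  | fapp l f args ih =>
    obtain ⟨hl, ht⟩ := ht
    obtain ⟨k, rfl⟩ := Option.isSome_iff_exists.1 hl
    have key : ∀ s : Δ.Srt, ∀ (x : M.Val w (Δ.hs (some k) s)) (y : M.Val w' (Δ.hs (some k) s)),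
        HEq x y → M.toCar x = M.toCar (w := w') y := by
      rintro (s | s) x y hxy <;> exact eq_of_heq hxy
    have key' : ∀ s : Δ.Srt, ∀ (x : M.Car (M.nom k) s),
        HEq (M.ofCar (w := w) (l := some k) x) (M.ofCar (w := w') (l := some k) x) := by
      rintro (s | s) x <;> rfl
    have : (fun i => M.toCar ((args i).eval M w)) =
        fun i => M.toCar (w := w') ((args i).eval M w') :=
      funext fun i => key _ _ _ (ih i (ht i))
    change HEq
      (M.ofCar (w := w) (l := some k) (M.ff (M.nom k) f fun i => M.toCar ((args i).eval M w)))
      (M.ofCar (w := w') (l := some k) (M.ff (M.nom k) f fun i => M.toCar ((args i).eval M w')))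
    rw [this]
    exact key' _ _

theorem Term.IsRigid.eval_eq {s : Δ.RSort} {t : Term Δ (Sum.inl s)} (ht : t.IsRigid)
    (w w' : M.W) : t.eval M w = t.eval M w' := eq_of_heq (ht.eval_heq M w w')

end Eval

/-! ### Reducts and the satisfaction condition -/

/-- The interpretation of the image of a rigid symbol; a term is evaluated at `w₀`. -/
def RImage.interp {Δ : Signature.{u}} (M : Kripke Δ) (w₀ : M.W) {a : Arity Δ.RSort}
    {s : Δ.RSort} (r : RImage Δ a s) (args : ∀ i, M.RC (a.dom i)) : M.RC s :=
  match r with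
  | sym g ha hc => M.rfAt g ha hc args
  | tm _ t => t.eval M w₀

namespace GHom

variable {Δ Δ' : Signature.{u}} (χ : GHom Δ Δ') (M : Kripke Δ')

/-- Carriers of the reduct are carriers of `M`; the two sets agree by cases on `s`. -/
def toCar (w : M.W) : {s : Δ.Srt} →
    Sum.elim (fun r => M.RC (χ.rs r)) (fun r => M.Car w (χ.fs r)) s → M.Car w (χ.smap s)
  | Sum.inl _, a => a
  | Sum.inr _, a => a

/-- The inverse of `GHom.toCar`. -/
def ofCar (w : M.W) : {s : Δ.Srt} →
    M.Car w (χ.smap s) → Sum.elim (fun r => M.RC (χ.rs r)) (fun r => M.Car w (χ.fs r)) s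
  | Sum.inl _, a => a
  | Sum.inr _, a => a

theorem nonempty_car {Δ : Signature.{u}} (M : Kripke Δ) (w : M.W) : ∀ s, Nonempty (M.Car w s)
  | Sum.inl _ => M.nonemptyRC _
  | Sum.inr _ => M.nonemptyFC w _

/-- The reduct of `M` along `χ`. Constants which `χ` maps to terms are interpreted by the values of
these terms at `w₀`; for rigid terms the choice of `w₀` does not matter. -/
def reduct (w₀ : M.W) : Kripke Δ where
  W := M.W
  nonemptyW := M.nonemptyW
  nom k := M.nom (χ.nom k)
  mod a := M.mod (χ.mod a)
  RC s := M.RC (χ.rs s)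
  nonemptyRC _ := M.nonemptyRC _
  FC w s := M.Car w (χ.fs s)
  nonemptyFC w _ := nonempty_car M w _
  rf f args := (χ.rf f).interp M w₀ args
  ff w f args := χ.ofCar M w (M.ffAt w (χ.ff f) (χ.ff_ar f) (χ.ff_cod f)
    (fun i => χ.toCar M w (args i)))
  rr p args := M.rrAt (χ.rr p) (χ.rr_ar p) args
  fr w p args := M.frAt w (χ.fr p) (χ.fr_ar p) (fun i => χ.toCar M w (args i))

/-- All terms to which `χ` maps constants are rigid. -/
def Rigid : Prop := ∀ (f : Δ.RFunc) ha t, χ.rf f = RImage.tm ha t → t.IsRigid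

/-- Values of hybrid terms in the reduct are values in `M`. -/
def toVal (w₀ w : M.W) : {h : Δ.HSort} → (χ.reduct M w₀).Val w h → M.Val w (χ.hmap h)
  | Sum.inl _, a => a
  | Sum.inr (none, _), a => M.ofCar (l := none) a
  | Sum.inr (some k, _), a => M.ofCar (l := some (χ.nom k)) a

theorem toVal_injective (w₀ w : M.W) (h : Δ.HSort) :
    Function.Injective (χ.toVal M w₀ w (h := h)) := by
  have key : ∀ (l : Option Δ'.Nom) (s : Δ'.Srt),
      Function.Injective (M.ofCar (w := w) (l := l) (s := s)) := by
    rintro l (s | s) x y hxy <;> exact hxy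
  rcases h with _ | ⟨_ | k, _⟩
  · exact fun _ _ h => h
  · exact key none _
  · exact key (some _) _

/-- The conversions between hybrid sorts in a translated application agree with the conversions
between carriers in the reduct. -/
theorem toCar_eval_toHs (w₀ w : M.W) {l : Option Δ.Nom} : ∀ {s : Δ.Srt}
    (t : Term Δ' (χ.hmap (Δ.hs l s))) (x : (χ.reduct M w₀).Val w (Δ.hs l s)),
    t.eval M w = χ.toVal M w₀ w x →
    HEq (M.toCar ((χ.toHs t).eval M w)) (χ.toCar M _ ((χ.reduct M w₀).toCar x)) := by
  have key : ∀ (l : Option Δ'.Nom) (s : Δ'.Srt) (x : M.Car (M.loc w l) s),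
      M.toCar (M.ofCar x) = x := by rintro l (s | s) x <;> rfl
  rintro (s | s) t x h <;> cases l
  · exact heq_of_eq h
  · exact heq_of_eq h
  · exact heq_of_eq ((congrArg M.toCar h).trans (key none _ _))
  · exact heq_of_eq ((congrArg M.toCar h).trans (key (some _) _ _))

variable {χ}

/-- The satisfaction condition for terms. Rigidity of `χ` is needed because the reduct interprets a
constant mapped to a term by the value at `w₀`, whereas the translated term is evaluated at `w`. -/
theorem eval_trans (hχ : χ.Rigid) (w₀ w : M.W) {h : Δ.HSort} (t : Term Δ h) :
    (t.trans χ).eval M w = χ.toVal M w₀ w (t.eval (χ.reduct M w₀) w) := by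
  induction t with
  | rapp f args ih =>
    change ((χ.rf f).app fun i => (args i).trans χ).eval M w =
      (χ.rf f).interp M w₀ (fun i => (args i).eval (χ.reduct M w₀) w)
    have ih' : (fun i => ((args i).trans χ).eval M w) =
      fun i => (args i).eval (χ.reduct M w₀) w := funext ih
    cases hr : χ.rf f with
    | sym g ha hc =>
      exact (Term.eval_mkRigid M w g ha hc _).trans (congrArg (M.rfAt g ha hc) ih')
    | tm ha t => exact (hχ f ha t hr).eval_eq M w w₀
  | fapp l f args ih =>
    have k1 : ∀ (s : Δ.Srt) (t : Term Δ' (Δ'.hs (l.map χ.nom) (χ.smap s)))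
        (x : M.Car (M.loc w (l.map χ.nom)) (χ.smap s))
        (y : (χ.reduct M w₀).Car ((χ.reduct M w₀).loc w l) s),
        t.eval M w = M.ofCar x → HEq x (χ.toCar M _ y) →
        (χ.ofHs t).eval M w = χ.toVal M w₀ w ((χ.reduct M w₀).ofCar y) := by
      rintro (s | s) t x y h1 h2 <;> cases l <;> cases eq_of_heq h2 <;> exact h1
    refine k1 _ _ (M.ffAt _ (χ.ff f) (χ.ff_ar f) (χ.ff_cod f)
      (fun i => M.toCar ((χ.toHs ((args i).trans χ)).eval M w))) _ (Term.eval_mk ..) ?_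
    have k4 : ∀ (s : Δ.Srt) (w' : M.W) (x : M.Car w' (χ.smap s)),
        χ.toCar M w' (χ.ofCar M w' x) = x := by
      rintro (s | s) w' x <;> rfl
    refine HEq.trans ?_ (heq_of_eq (k4 _ _ _).symm)
    cases l <;>
    · refine heq_of_eq (congrArg (M.ffAt _ (χ.ff f) (χ.ff_ar f) (χ.ff_cod f)) ?_)
      exact funext fun i => eq_of_heq (toCar_eval_toHs χ M w₀ w _ _ (ih i))

/-- Structures with the same sorts, flexible symbols and modalities are equal as soon as they agree
on nominals, functions and relations. -/
theorem _root_.HDFOLR.Kripke.ext_symbols {Δ : Signature.{u}} (N : Kripke Δ) {nom rf ff rr fr}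
    (h₁ : ∀ k, nom k = N.nom k) (h₂ : ∀ f args, rf f args = N.rf f args)
    (h₃ : ∀ w f args, ff w f args = N.ff w f args) (h₄ : ∀ p args, rr p args = N.rr p args)
    (h₅ : ∀ w p args, fr w p args = N.fr w p args) :
    { N with nom := nom, rf := rf, ff := ff, rr := rr, fr := fr } = N := by
  obtain rfl : nom = N.nom := funext h₁
  obtain rfl : rf = N.rf := funext fun f => funext (h₂ f)
  obtain rfl : ff = N.ff := funext fun w => funext fun f => funext (h₃ w f)
  obtain rfl : rr = N.rr := funext fun p => funext (h₄ p)
  obtain rfl : fr = N.fr := funext fun w => funext fun p => funext (h₅ w p)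
  rfl

/-- If the translation of sorts is the identity, then so are the conversions between carriers. -/
theorem ffAt_conv (M : Kripke Δ) (w : M.W) (g : Δ.Srt → Δ.Srt) (hg : ∀ s, g s = s) (f : Δ.Func)
    (ha : Δ.ar f = (Δ.ar f).map g) (hc : Δ.cod f = g (Δ.cod f))
    (toC : ∀ s, M.Car w s → M.Car w (g s)) (ofC : ∀ s, M.Car w (g s) → M.Car w s)
    (h₁ : ∀ s x, HEq (toC s x) x) (h₂ : ∀ s x, HEq (ofC s x) x)
    (args : ∀ i, M.Car w ((Δ.ar f).dom i)) :
    ofC _ (M.ffAt w f ha hc (fun i => toC _ (args i))) = M.ffAt w f rfl rfl args := by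
  obtain rfl : g = id := funext hg
  obtain rfl : toC = fun _ x => x := funext fun s => funext fun x => eq_of_heq (h₁ s x)
  obtain rfl : ofC = fun _ x => x := funext fun s => funext fun x => eq_of_heq (h₂ s x)
  rfl

/-- The analogue of `ffAt_conv` for relations. -/
theorem frAt_conv (M : Kripke Δ) (w : M.W) (g : Δ.Srt → Δ.Srt) (hg : ∀ s, g s = s) (p : Δ.Rel)
    (ha : Δ.relAr p = (Δ.relAr p).map g) (toC : ∀ s, M.Car w s → M.Car w (g s))
    (h₁ : ∀ s x, HEq (toC s x) x) (args : ∀ i, M.Car w ((Δ.relAr p).dom i)) :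
    M.frAt w p ha (fun i => toC _ (args i)) = M.frAt w p rfl args := by
  obtain rfl : g = id := funext hg
  obtain rfl : toC = fun _ x => x := funext fun s => funext fun x => eq_of_heq (h₁ s x)
  rfl

/-- The reduct of an expansion is the original structure. -/
theorem reduct_incl {Δ : Signature.{u}} (M : Kripke Δ) {C : Consts Δ} (ν : M.Assignment C)
    (w₀ : M.W) : (Hom.incl Δ C).toGHom.reduct (M.expand ν) w₀ = M := by
  refine Kripke.ext_symbols M (fun _ => rfl) (fun _ _ => rfl) (fun w f args => ?_)
    (fun _ _ => rfl) (fun w p args => ?_)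
  · exact ffAt_conv (M.expand ν) w (Hom.incl Δ C).smap (by rintro (s | s) <;> rfl) (Sum.inr f)
      ((Hom.incl Δ C).ff_ar f) ((Hom.incl Δ C).ff_cod f)
      (fun s => (Hom.incl Δ C).toGHom.toCar (M.expand ν) w (s := s))
      (fun s => (Hom.incl Δ C).toGHom.ofCar (M.expand ν) w (s := s))
      (by rintro (s | s) x <;> rfl) (by rintro (s | s) x <;> rfl) args
  · exact frAt_conv (M.expand ν) w (Hom.incl Δ C).smap (by rintro (s | s) <;> rfl) (Sum.inr p)
      ((Hom.incl Δ C).fr_ar p) (fun s => (Hom.incl Δ C).toGHom.toCar (M.expand ν) w (s := s))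
      (by rintro (s | s) x <;> rfl) args

theorem reduct_id {Δ : Signature.{u}} (M : Kripke Δ)
    (w₀ : M.W) : (Hom.id Δ).toGHom.reduct M w₀ = M := by
  refine Kripke.ext_symbols M (fun _ => rfl) (fun _ _ => rfl) (fun w f args => ?_)
    (fun _ _ => rfl) (fun w p args => ?_)
  · exact ffAt_conv M w (Hom.id Δ).smap (by rintro (s | s) <;> rfl) (Sum.inr f)
      ((Hom.id Δ).ff_ar f) ((Hom.id Δ).ff_cod f)
      (fun s => (Hom.id Δ).toGHom.toCar M w (s := s))
      (fun s => (Hom.id Δ).toGHom.ofCar M w (s := s))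
      (by rintro (s | s) x <;> rfl) (by rintro (s | s) x <;> rfl) args
  · exact frAt_conv M w (Hom.id Δ).smap (by rintro (s | s) <;> rfl) (Sum.inr p)
      ((Hom.id Δ).fr_ar p) (fun s => (Hom.id Δ).toGHom.toCar M w (s := s))
      (by rintro (s | s) x <;> rfl) args

theorem reduct_incl_incl {Δ : Signature.{u}} (M : Kripke Δ) {C : Consts Δ} (ν : M.Assignment C)
    {D : Consts (Δ.ext C)} (κ : (M.expand ν).Assignment D) (w₀ : M.W) :
    ((Hom.incl Δ C).comp (Hom.incl (Δ.ext C) D)).toGHom.reduct ((M.expand ν).expand κ) w₀ = M := by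
  refine Kripke.ext_symbols M (fun _ => rfl) (fun _ _ => rfl) (fun w f args => ?_)
    (fun _ _ => rfl) (fun w p args => ?_)
  · exact ffAt_conv ((M.expand ν).expand κ) w ((Hom.incl Δ C).comp (Hom.incl (Δ.ext C) D)).smap
      (by rintro (s | s) <;> rfl) (Sum.inr f)
      (((Hom.incl Δ C).comp (Hom.incl (Δ.ext C) D)).ff_ar f)
      (((Hom.incl Δ C).comp (Hom.incl (Δ.ext C) D)).ff_cod f)
      (fun s => ((Hom.incl Δ C).comp (Hom.incl (Δ.ext C) D)).toGHom.toCar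
        ((M.expand ν).expand κ) w (s := s))
      (fun s => ((Hom.incl Δ C).comp (Hom.incl (Δ.ext C) D)).toGHom.ofCar
        ((M.expand ν).expand κ) w (s := s))
      (by rintro (s | s) x <;> rfl) (by rintro (s | s) x <;> rfl) args
  · exact frAt_conv ((M.expand ν).expand κ) w ((Hom.incl Δ C).comp (Hom.incl (Δ.ext C) D)).smap
      (by rintro (s | s) <;> rfl) (Sum.inr p)
      (((Hom.incl Δ C).comp (Hom.incl (Δ.ext C) D)).fr_ar p)
      (fun s => ((Hom.incl Δ C).comp (Hom.incl (Δ.ext C) D)).toGHom.toCar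
        ((M.expand ν).expand κ) w (s := s))
      (by rintro (s | s) x <;> rfl) args

/-- Signature morphisms map no constant to a term. -/
theorem rigid_toGHom (χ : Hom Δ Δ') : χ.toGHom.Rigid := fun _ _ _ h => nomatch h

theorem eval_map_incl {Δ : Signature.{u}} (M : Kripke Δ) {C : Consts Δ} (ν : M.Assignment C)
    (w : M.W) {s : Δ.RSort} (t : Term Δ (Sum.inl s)) :
    (t.trans (Hom.incl Δ C).toGHom).eval (M.expand ν) w = t.eval M w := by
  refine (eval_trans (M.expand ν) (rigid_toGHom _) w w t).trans ?_
  have key : ∀ (N : Kripke Δ) (w' : N.W), N = M → HEq w' w → HEq (t.eval N w') (t.eval M w) := by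
    rintro N w' rfl h
    cases h
    rfl
  exact eq_of_heq (key ((Hom.incl Δ C).toGHom.reduct (M.expand ν) w) w (reduct_incl M ν w) HEq.rfl)

theorem rfAt_expand (M : Kripke Δ) {C : Consts Δ} (ν : M.Assignment C)
    {a : Arity Δ.RSort} {s : Δ.RSort} (g : Δ.RFunc) (ha : Δ.rar g = a) (hc : Δ.rcod g = s) (ha' hc')
    (args : ∀ i, M.RC (a.dom i)) :
    (M.expand ν).rfAt (Sum.inl g) (a := a) (s := s) ha' hc' args = M.rfAt g ha hc args := by
  subst ha hc
  rfl

theorem rrAt_expand (M : Kripke Δ) {C : Consts Δ} (ν : M.Assignment C)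
    {a : Arity Δ.RSort} (p : Δ.RRel) (ha : Δ.rrar p = a) (ha') (args : ∀ i, M.RC (a.dom i)) :
    (M.expand ν).rrAt p (a := a) ha' args = M.rrAt p ha args := by
  subst ha
  rfl

theorem ffAt_expand (M : Kripke Δ) {C : Consts Δ} (ν : M.Assignment C) (w : M.W)
    {a : Arity Δ.Srt} {s : Δ.Srt} (g : Δ.Func) (ha : Δ.ar g = a) (hc : Δ.cod g = s) (ha' hc')
    (args : ∀ i, M.Car w (a.dom i)) :
    (M.expand ν).ffAt w (Sum.map Sum.inl id g : (Δ.ext C).Func) (a := a) (s := s) ha' hc' args =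
      M.ffAt w g ha hc args := by
  subst ha hc
  cases g <;> rfl

theorem frAt_expand (M : Kripke Δ) {C : Consts Δ} (ν : M.Assignment C) (w : M.W)
    {a : Arity Δ.Srt} (p : Δ.Rel) (ha : Δ.relAr p = a) (ha')
    (args : ∀ i, M.Car w (a.dom i)) :
    (M.expand ν).frAt w (p : (Δ.ext C).Rel) (a := a) ha' args = M.frAt w p ha args := by
  subst ha
  cases p <;> rfl

theorem interp_weaken (M : Kripke Δ) {C : Consts Δ} (ν : M.Assignment C) (w₀ : M.W)
    {a : Arity Δ.RSort} {s : Δ.RSort} (r : RImage Δ a s) (args : ∀ i, M.RC (a.dom i)) :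
    (r.weaken C).interp (M.expand ν) w₀ args = r.interp M w₀ args := by
  cases r with
  | sym g ha hc => exact rfAt_expand M ν g ha hc _ _ args
  | tm ha t => exact eval_map_incl M ν w₀ t

/-- Reducts commute with expansions by the new constants; this is what the satisfaction condition
needs under a binder. -/
theorem reduct_ext (C : Consts Δ) (C' : Consts Δ') (gN : C.N → C'.N) (gD : C.D → C'.D)
    (hD : ∀ d, C'.srt (gD d) = χ.rs (C.srt d)) (ν : M.Assignment C') (w₀ : M.W)
    (μ : (χ.reduct M w₀).Assignment C) (hN : ∀ k, μ.nom k = ν.nom (gN k))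
    (hμ : ∀ d, HEq (μ.con d) (ν.con (gD d))) :
    (χ.ext C C' gN gD hD).reduct (M.expand ν) w₀ = (χ.reduct M w₀).expand μ := by
  have toC : ∀ (w : M.W) (s : Δ.Srt) (x),
      (χ.ext C C' gN gD hD).toCar (M.expand ν) w (s := s) x = χ.toCar M w x := by
    rintro w (s | s) x <;> rfl
  have ofC : ∀ (w : M.W) (s : Δ.Srt) (x),
      (χ.ext C C' gN gD hD).ofCar (M.expand ν) w (s := s) x = χ.ofCar M w x := by
    rintro w (s | s) x <;> rfl
  refine Kripke.ext_symbols ((χ.reduct M w₀).expand μ) ?_ ?_ ?_ ?_ ?_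
  · rintro (k | k)
    · rfl
    · exact (hN k).symm
  · rintro (f | d) args
    · exact interp_weaken M ν w₀ (χ.rf f) args
    · have key : ∀ {a : Arity Δ'.RSort} {s} (ha : Arity.nil = a) (hc : C'.srt (gD d) = s) (args),
          HEq ((M.expand ν).rfAt (Sum.inr (gD d)) (a := a) (s := s) ha hc args)
            (ν.con (gD d)) := by
        intro a s ha hc args
        subst ha hc
        rfl
      exact eq_of_heq ((key _ (hD d) _).trans (hμ d).symm)
  · intro w f args
    refine (ofC w _ _).trans (congrArg (χ.ofCar M w) ?_)
    refine Eq.trans ?_ (ffAt_expand M ν w (χ.ff f) (χ.ff_ar f) (χ.ff_cod f)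
      ((χ.ext C C' gN gD hD).ff_ar f) ((χ.ext C C' gN gD hD).ff_cod f) _)
    exact congrArg ((M.expand ν).ffAt w _ ((χ.ext C C' gN gD hD).ff_ar f)
      ((χ.ext C C' gN gD hD).ff_cod f)) (funext fun i => toC w _ (args i))
  · intro p args
    exact rrAt_expand M ν (χ.rr p) (χ.rr_ar p) _ _
  · intro w p args
    refine Eq.trans ?_ (frAt_expand M ν w (χ.fr p) (χ.fr_ar p)
      ((χ.ext C C' gN gD hD).fr_ar p) _)
    exact congrArg ((M.expand ν).frAt w _ ((χ.ext C C' gN gD hD).fr_ar p))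
      (funext fun i => toC w _ (args i))

theorem rigid_trans_incl {Δ : Signature.{u}} (C : Consts Δ) {h : Δ.HSort} {t : Term Δ h}
    (ht : t.IsRigid) : (t.trans (Hom.incl Δ C).toGHom).IsRigid := by
  have toHs : ∀ (l : Option Δ.Nom) (s : Δ.Srt)
      (t : Term (Δ.ext C) ((Hom.incl Δ C).hmap (Δ.hs l s))),
      t.IsRigid → ((Hom.incl Δ C).toHs t).IsRigid := by rintro l (s | s) t h <;> exact h
  have ofHs : ∀ (l : Option Δ.Nom) (s : Δ.Srt) (t), Term.IsRigid t →
      ((Hom.incl Δ C).ofHs (l := l) (s := s) t).IsRigid := by rintro l (s | s) t h <;> exact h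
  have mk : ∀ {a : Arity Δ.Srt} {s : Δ.Srt} (l : Option (Δ.ext C).Nom) (g : (Δ.ext C).Func)
      (ha : (Δ.ext C).ar g = a) (hc : (Δ.ext C).cod g = s)
      (args : ∀ i, Term (Δ.ext C) ((Δ.ext C).hs l (a.dom i))), l.isSome →
      (∀ i, (args i).IsRigid) → (Term.mk l g ha hc args).IsRigid := by
    rintro a s l (g | g) rfl rfl args hl h
    · exact h
    · exact ⟨hl, h⟩
  induction t with
  | rapp f args ih => exact fun i => ih i (ht i)
  | fapp l f args ih =>
    refine ofHs _ _ _ (mk (s := (Hom.incl Δ C).smap (Δ.fcod f)) _ _ _ _ _ ?_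
      fun i => toHs _ _ _ (ih i (ht.2 i)))
    simpa using ht.1

theorem Rigid.ext (hχ : χ.Rigid) (C : Consts Δ) (C' : Consts Δ') (gN : C.N → C'.N)
    (gD : C.D → C'.D) (hD) : (χ.ext C C' gN gD hD).Rigid := by
  rintro (f | d) ha t h
  · change (χ.rf f).weaken C' = _ at h
    cases hr : χ.rf f with
    | sym g ha hc => rw [hr] at h; cases h
    | tm ha t => rw [hr] at h; cases h; exact rigid_trans_incl C' (hχ f ha t hr)
  · cases h

theorem interp_map (χ : Δ.Mod → Δ'.Mod) (R : Δ'.Mod → M.W → M.W → Prop) (a : Action Δ.Mod) :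
    (a.map χ).interp R = a.interp fun m => R (χ m) := by
  induction a with
  | atom a => rfl
  | seq a b iha ihb => simp only [Action.map, Action.interp, iha, ihb]
  | union a b iha ihb => simp only [Action.map, Action.interp, iha, ihb]
  | star a ih => simp only [Action.map, Action.interp, ih]

end GHom

theorem Sen.sat_congr {Δ : Signature.{u}} (γ : Sen Δ) {M N : Kripke Δ} (h : M = N) {w : M.W}
    {v : N.W} (hw : HEq w v) : γ.Sat M w ↔ γ.Sat N v := by
  subst h
  cases hw
  rfl

/-- The satisfaction condition. -/
theorem Sen.sat_trans {Δ Δ' : Signature.{u}} (γ : Sen Δ) (χ : GHom Δ Δ') (hχ : χ.Rigid)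
    (M : Kripke Δ')
    (w₀ w : M.W) :
    (γ.trans χ).Sat M w ↔ γ.Sat (χ.reduct M w₀) w := by
  induction γ generalizing Δ' with
  | nom k => rfl
  | eq t₁ t₂ =>
    change (t₁.trans χ).eval M w = (t₂.trans χ).eval M w ↔ _
    rw [GHom.eval_trans M hχ w₀, GHom.eval_trans M hχ w₀]
    exact (χ.toVal_injective M w₀ w _).eq_iff
  | rrel p args =>
    refine (Sen.sat_mkRRel M w (χ.rr p) (χ.rr_ar p) _).trans (Eq.to_iff ?_)
    exact congrArg (M.rrAt (χ.rr p) (χ.rr_ar p))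
      (funext fun i => GHom.eval_trans M hχ w₀ w (args i))
  | frel l p args =>
    refine (Sen.sat_mkRel M w (l.map χ.nom) (χ.fr p) (χ.fr_ar p) _).trans (Eq.to_iff ?_)
    cases l <;>
    · refine congrArg (M.frAt _ (χ.fr p) (χ.fr_ar p)) (funext fun i => ?_)
      exact eq_of_heq (GHom.toCar_eval_toHs χ M w₀ w _ _ (GHom.eval_trans M hχ w₀ w (args i)))
  | retr k γ ih => exact ih χ hχ M w₀ _
  | neg γ ih => exact not_congr (ih χ hχ M w₀ w)
  | or γ ih => exact exists_congr fun i => ih i χ hχ M w₀ w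
  | store γ ih =>
    refine (ih χ.extNominal (hχ.ext _ _ _ _ _) (M.expand _) w₀ w).trans (Sen.sat_congr _ ?_ HEq.rfl)
    exact GHom.reduct_ext M _ _ _ _ _ _ _ _ (fun _ => rfl) (fun d => d.down.elim0)
  | ex X γ ih =>
    have key : ∀ (ν : M.Assignment (χ.mapVars X).toConsts),
        (γ.trans (χ.extv X)).Sat (M.expand ν) w ↔
          γ.Sat ((χ.reduct M w₀).expand (C := X.toConsts) ⟨ν.nom, ν.con⟩) w := fun ν =>
      (ih (χ.extv X) (hχ.ext _ _ _ _ _) (M.expand ν) w₀ w).trans (Sen.sat_congr _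
        (GHom.reduct_ext M _ _ _ _ _ _ _ _ (fun _ => rfl) (fun _ => HEq.rfl)) HEq.rfl)
    exact ⟨fun ⟨ν, h⟩ => ⟨⟨ν.nom, ν.con⟩, (key ν).1 h⟩,
      fun ⟨ν, h⟩ => ⟨⟨ν.nom, ν.con⟩, (key ⟨ν.nom, ν.con⟩).2 h⟩⟩
  | poss a γ ih =>
    change (∃ v, (a.map χ.mod).interp M.mod w v ∧ _) ↔ _
    rw [GHom.interp_map]
    exact exists_congr fun v => and_congr Iff.rfl (ih χ hχ M w₀ v)

/-! ### Semantics of substitutions -/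

theorem Kripke.expand_congr {Δ : Signature.{u}} {K M : Kripke Δ} (h : K = M) {C : Consts Δ}
    {ν : K.Assignment C} {ν' : M.Assignment C} (hn : HEq ν.nom ν'.nom) (hc : HEq ν.con ν'.con) :
    K.expand ν = M.expand ν' := by
  subst h
  obtain ⟨n, c⟩ := ν
  obtain ⟨n', c'⟩ := ν'
  cases hn
  cases hc
  rfl

theorem Term.eval_congr {Δ : Signature.{u}} {s : Δ.RSort} (t : Term Δ (Sum.inl s))
    {M N : Kripke Δ} (h : M = N) {w : M.W} {v : N.W} (hw : HEq w v) :
    HEq (t.eval M w) (t.eval N v) := by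
  subst h
  cases hw
  rfl

theorem GHom.eval_trans_rigidSort {Δ Δ' : Signature.{u}} {χ : GHom Δ Δ'} (hχ : χ.Rigid)
    (N : Kripke Δ') (w : N.W) {M : Kripke Δ} (h : χ.reduct N w = M) {s : Δ.RSort}
    (t : Term Δ (Sum.inl s)) {v : M.W} (hv : HEq w v) :
    HEq ((t.trans χ).eval N w) (t.eval M v) :=
  (heq_of_eq (GHom.eval_trans N hχ w w t)).trans (t.eval_congr h hv)

theorem Sen.sat_map_incl {Δ : Signature.{u}} (γ : Sen Δ) (M : Kripke Δ) {C : Consts Δ}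
    (ν : M.Assignment C) (w : M.W) : (γ.map (Hom.incl Δ C)).Sat (M.expand ν) w ↔ γ.Sat M w :=
  (γ.sat_trans _ (GHom.rigid_toGHom _) (M.expand ν) w w).trans
    (γ.sat_congr (GHom.reduct_incl M ν w) HEq.rfl)

theorem Kripke.models_map_incl {Δ : Signature.{u}} (M : Kripke Δ) {C : Consts Δ}
    (ν : M.Assignment C) (T : Set (Sen Δ)) :
    (M.expand ν).Models (Sen.map (Hom.incl Δ C) '' T) ↔ M.Models T :=
  ⟨fun h γ hγ w => (γ.sat_map_incl M ν w).1 (h _ ⟨γ, hγ, rfl⟩ w),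
    fun h _ ⟨γ, hγ, e⟩ w => e ▸ (γ.sat_map_incl M ν w).2 (h γ hγ w)⟩

/-- Every structure over `Δ[C]` is an expansion of a structure over `Δ`. -/
theorem Kripke.exists_expand {Δ : Signature.{u}} {C : Consts Δ} (N : Kripke (Δ.ext C)) :
    ∃ (M : Kripke Δ) (ν : M.Assignment C), N = M.expand ν := by
  refine ⟨{ W := N.W, nonemptyW := N.nonemptyW, nom := fun k => N.nom (Sum.inl k), mod := N.mod,
            RC := N.RC, nonemptyRC := N.nonemptyRC, FC := N.FC, nonemptyFC := N.nonemptyFC,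
            rf := fun f => N.rf (Sum.inl f), ff := N.ff, rr := N.rr, fr := N.fr },
    ⟨fun k => N.nom (Sum.inr k), fun d => N.rf (Sum.inr d) fun i => i.elim0⟩, ?_⟩
  refine (Kripke.ext_symbols N ?_ ?_ (fun _ _ _ => rfl) (fun _ _ => rfl) (fun _ _ _ => rfl)).symm
  · rintro (k | k) <;> rfl
  · rintro (f | d) args
    · rfl
    · exact congrArg (N.rf (Sum.inr d)) (funext fun i => i.elim0)

namespace Subst

variable {Δ Δ' : Signature.{u}} {ι : Hom Δ Δ'} {C : Consts Δ}

theorem rigid_toGHom (θ : Subst ι C) : θ.toGHom.Rigid := by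
  rintro (f | d) ha t h
  · cases h
  · cases h; exact θ.rigid d

/-- The reduct along a substitution expands the reduct along the underlying inclusion by the values
of the substituted nominals and terms. -/
theorem reduct_toGHom (θ : Subst ι C) (N : Kripke Δ') (w₀ : N.W) :
    θ.toGHom.reduct N w₀ = (ι.toGHom.reduct N w₀).expand
      ⟨fun x => N.nom (θ.nom x), fun d => (θ.con d).eval N w₀⟩ := by
  have toC : ∀ (w : N.W) (s : Δ.Srt) (x),
      θ.toGHom.toCar N w (s := s) x = ι.toGHom.toCar N w x := by
    rintro w (s | s) x <;> rfl
  have ofC : ∀ (w : N.W) (s : Δ.Srt) (x),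
      θ.toGHom.ofCar N w (s := s) x = ι.toGHom.ofCar N w x := by
    rintro w (s | s) x <;> rfl
  refine Kripke.ext_symbols ((ι.toGHom.reduct N w₀).expand
      ⟨fun x => N.nom (θ.nom x), fun d => (θ.con d).eval N w₀⟩) ?_ ?_ (fun w f args => ?_)
      (fun _ _ => rfl) (fun w p args => ?_)
  · rintro (k | k) <;> rfl
  · rintro (f | d) args <;> rfl
  · exact (ofC w _ _).trans (congrArg (fun a => ι.toGHom.ofCar N w
      (N.ffAt w (ι.ff f) (ι.ff_ar f) (ι.ff_cod f) a)) (funext fun i => toC w _ (args i)))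
  · exact congrArg (N.frAt w (ι.fr p) (ι.fr_ar p)) (funext fun i => toC w _ (args i))

/-- The interpretation of the variables in `X` by the values of the nominals and terms which `θ`
substitutes for them. -/
noncomputable def value {X : Consts Δ} (θ : Subst (Hom.incl Δ C) X) {M : Kripke Δ}
    (μ : M.Assignment C) : M.Assignment X where
  nom x := (M.expand μ).nom (θ.nom x)
  con d := (θ.con d).eval (M.expand μ) (Classical.choice M.nonemptyW)

theorem reduct_expand {X : Consts Δ} (θ : Subst (Hom.incl Δ C) X) {M : Kripke Δ}
    (μ : M.Assignment C) (w : M.W) :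
    θ.toGHom.reduct (M.expand μ) w = M.expand (θ.value μ) := by
  have h : (fun d => (θ.con d).eval (M.expand μ) w) = (θ.value μ).con :=
    funext fun d => (θ.rigid d).eval_eq _ _ _
  refine (θ.reduct_toGHom (M.expand μ) w).trans
    (Kripke.expand_congr (GHom.reduct_incl M μ w) HEq.rfl (heq_of_eq h))

theorem sat_subst {X : Consts Δ} (θ : Subst (Hom.incl Δ C) X) {M : Kripke Δ}
    (μ : M.Assignment C) (γ : Sen (Δ.ext X)) (w : M.W) :
    (γ.subst θ).Sat (M.expand μ) w ↔ γ.Sat (M.expand (θ.value μ)) w :=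
  (γ.sat_trans _ θ.rigid_toGHom (M.expand μ) w w).trans
    (γ.sat_congr (θ.reduct_expand μ w) HEq.rfl)

theorem sat_subst_ofNominal (k : Δ.Nom) (M : Kripke Δ)
    (γ : Sen (Δ.extv (Vars.nominal Δ))) (w : M.W) :
    (γ.subst (ofNominal k)).Sat M w ↔ γ.Sat (M.expand (C := (Vars.nominal Δ).toConsts)
      ⟨fun _ => M.nom k, fun d => d.down.elim0⟩) w := by
  refine (γ.sat_trans _ (rigid_toGHom _) M w w).trans (γ.sat_congr ?_ HEq.rfl)
  refine (reduct_toGHom _ M w).trans (Kripke.expand_congr (GHom.reduct_id M w) HEq.rfl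
    (heq_of_eq (funext fun d => d.down.elim0)))

end Subst

/-! ### Exchanging new constants for variables -/

theorem Term.isRigid_mkRigid {Δ : Signature.{u}} {a : Arity Δ.RSort} {s : Δ.RSort} (g : Δ.RFunc)
    (ha : Δ.rar g = a) (hc : Δ.rcod g = s) (args : ∀ i, Term Δ (Sum.inl (a.dom i)))
    (h : ∀ i, (args i).IsRigid) : (Term.mkRigid g ha hc args).IsRigid := by
  subst ha hc; exact h

/-- A finite set `C` of new constants can be exchanged for a finite set `Y` of variables over
`Δ[X]`, so that `Δ[C]` is translated to `Δ[X][Y]`. -/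
theorem exists_vars_of_finite {Δ : Signature.{u}} (X : Vars Δ) (C : Consts Δ) [Finite C.N]
    [Finite C.D] :
    ∃ (Y : Vars (Δ.extv X))
      (Θ : Subst (((Extension.refl (Δ := Δ)).step X.toConsts).step Y.toConsts).incl C),
      ∀ (M : Kripke Δ) (ν : M.Assignment X.toConsts),
        ∃ back : (M.expand ν).Assignment Y.toConsts → M.Assignment C,
          Function.Surjective back ∧ ∀ κ w,
            Θ.toGHom.reduct ((M.expand ν).expand κ) w = M.expand (back κ) := by
  obtain ⟨n, ⟨eN⟩⟩ := Finite.exists_equiv_fin C.N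
  obtain ⟨m, ⟨eD⟩⟩ := Finite.exists_equiv_fin C.D
  have hD : ∀ d, C.srt (eD.symm (eD d)) = C.srt d := fun d => by rw [eD.symm_apply_apply]
  let Y : Vars (Δ.extv X) := ⟨n, m, fun i => C.srt (eD.symm i)⟩
  let Θ : Subst (((Extension.refl (Δ := Δ)).step X.toConsts).step Y.toConsts).incl C :=
    { nom := fun c => Sum.inr ⟨eN c⟩
      con := fun d => Term.mkRigid (Δ := (Δ.extv X).extv Y) (a := Arity.nil) (Sum.inr ⟨eD d⟩) rfl
        (hD d) (fun i => i.elim0)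
      rigid := fun d => Term.isRigid_mkRigid _ _ _ _ fun i => i.elim0 }
  refine ⟨Y, Θ, fun M ν => ⟨fun κ => ⟨fun c => κ.nom ⟨eN c⟩,
    fun d => cast (congrArg M.RC (hD d)) (κ.con ⟨eD d⟩)⟩, ?_, ?_⟩⟩
  · intro μ
    refine ⟨⟨fun i => μ.nom (eN.symm i.down), fun i => μ.con (eD.symm i.down)⟩, ?_⟩
    have h₁ : (fun c => μ.nom (eN.symm (eN c))) = μ.nom :=
      funext fun c => by rw [eN.symm_apply_apply]
    have h₂ : (fun d => cast (congrArg M.RC (hD d)) (μ.con (eD.symm (eD d)))) = μ.con := by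
      have key : ∀ d d' (e : d' = d) (h : M.RC (C.srt d') = M.RC (C.srt d)),
          cast h (μ.con d') = μ.con d := by rintro d _ rfl h; rfl
      exact funext fun d => key _ _ (eD.symm_apply_apply d) _
    exact congrArg₂ (Kripke.Assignment.mk (M := M)) h₁ h₂
  · intro κ w
    refine (Θ.reduct_toGHom _ w).trans
      (Kripke.expand_congr (GHom.reduct_incl_incl M ν κ w) HEq.rfl
        (heq_of_eq (funext fun d => ?_)))
    have key : ∀ (s : Δ.RSort) (h : C.srt (eD.symm (eD d)) = s) (args),
        ((M.expand ν).expand κ).rfAt (a := Arity.nil) (s := s) (Sum.inr ⟨eD d⟩) rfl h args =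
          cast (congrArg M.RC h) (κ.con ⟨eD d⟩) := by
      rintro s rfl args; rfl
    exact (Term.eval_mkRigid _ w _ _ _ _).trans (key _ (hD d) _)

/-! ### Sentences expressible in a fragment -/

namespace Fragment

variable {L : Fragment.{u}} {Δ : Signature.{u}}

theorem Expresses.of_equiv {γ γ' : Sen Δ} (h : L.Expresses γ) (e : γ.Equiv γ') :
    L.Expresses γ' :=
  h.imp fun _ ⟨hφ, h⟩ => ⟨hφ, fun M w => (h M w).trans (e M w)⟩

theorem Expresses.neg (hNeg : L.ClosedNeg) (hΔ : Δ ∈ L.sig) {γ : Sen Δ} (h : L.Expresses γ) :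
    L.Expresses (Sen.neg γ) :=
  let ⟨φ, hφ, e⟩ := h
  (hNeg Δ hΔ φ hφ).of_equiv fun M w => not_congr (e M w)

theorem Expresses.retr (hRetr : L.ClosedRetr) (hΔ : Δ ∈ L.sig) {γ : Sen Δ} (h : L.Expresses γ)
    (k : Δ.Nom) : L.Expresses (Sen.retr k γ) :=
  let ⟨φ, hφ, e⟩ := h
  (hRetr Δ hΔ φ hφ k).of_equiv fun M _ => e M _

theorem Expresses.ex (hEx : L.ClosedEx) (hΔ : Δ ∈ L.sig) {X : Vars Δ} {γ : Sen (Δ.extv X)}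
    (h : L.Expresses γ) : L.Expresses (Sen.ex X γ) :=
  let ⟨φ, hφ, e⟩ := h
  (hEx Δ hΔ X φ hφ).of_equiv fun M w => exists_congr fun ν => e (M.expand ν) w

theorem Expresses.all (hNeg : L.ClosedNeg) (hEx : L.ClosedEx) (hΔ : Δ ∈ L.sig) {X : Vars Δ}
    {γ : Sen (Δ.extv X)} (h : L.Expresses γ) : L.Expresses (Sen.all X γ) :=
  ((h.neg hNeg (L.ext_sig Δ hΔ _)).ex hEx hΔ).neg hNeg hΔ

theorem _root_.HDFOLR.Sen.sat_all {X : Vars Δ} (γ : Sen (Δ.extv X)) (M : Kripke Δ) (w : M.W) :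
    (Sen.all X γ).Sat M w ↔ ∀ ν : M.Assignment X.toConsts, γ.Sat (M.expand ν) w :=
  not_exists_not

/-- Finite conjunctions are expressible. -/
theorem exists_conj (hNeg : L.ClosedNeg) (hOr : L.ClosedOr) (hΔ : Δ ∈ L.sig) {q : Set (Sen Δ)}
    (hq : q.Finite) (hqL : q ⊆ L.sen Δ) :
    ∃ δ ∈ L.sen Δ, ∀ (M : Kripke Δ) (w : M.W), δ.Sat M w ↔ ∀ γ ∈ q, γ.Sat M w := by
  have := hq.to_subtype
  obtain ⟨n, ⟨e⟩⟩ := Finite.exists_equiv_fin q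
  choose f hf hfe using fun i => hNeg Δ hΔ (e.symm i).1 (hqL (e.symm i).2)
  obtain ⟨δ, hδ, hδe⟩ := Expresses.neg hNeg hΔ (hOr Δ hΔ n f hf)
  refine ⟨δ, hδ, fun M w => (hδe M w).trans ?_⟩
  change (¬ ∃ i, (f i).Sat M w) ↔ _
  rw [not_exists]
  refine ⟨fun h γ hγ => ?_, fun h i hi => (hfe i M w).1 hi (h _ (e.symm i).2)⟩
  by_contra hc
  refine h (e ⟨γ, hγ⟩) ((hfe _ M w).2 ?_)
  rw [e.symm_apply_apply]
  exact hc

/-- Truth at all worlds is expressible: `δ` holds everywhere iff there is no `z` such that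
`@_z ¬ δ`. -/
theorem exists_everywhere (hNeg : L.ClosedNeg) (hRetr : L.ClosedRetr) (hEx : L.ClosedEx)
    (hΔ : Δ ∈ L.sig) {δ : Sen Δ} (hδ : δ ∈ L.sen Δ) :
    ∃ φ ∈ L.sen Δ, ∀ (M : Kripke Δ) (w : M.W), φ.Sat M w ↔ ∀ v, δ.Sat M v := by
  have hX := L.ext_sig Δ hΔ (Vars.nominal Δ).toConsts
  have hmap := L.map_mem (Hom.incl Δ (Vars.nominal Δ).toConsts) hΔ hX (L.ext_mor Δ hΔ _) δ hδ
  obtain ⟨φ, hφ, e⟩ := Expresses.all hNeg hEx hΔ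
    (Expresses.retr hRetr hX ⟨_, hmap, fun _ _ => Iff.rfl⟩ (Sum.inr ⟨(0 : Fin 1)⟩))
  refine ⟨φ, hφ, fun M w => ((e M w).trans (Sen.sat_all _ M w)).trans ?_⟩
  refine ⟨fun h v => ?_, fun h ν => (δ.sat_map_incl M ν _).2 (h _)⟩
  exact (δ.sat_map_incl M _ _).1 (h ⟨fun _ => v, fun d => d.down.elim0⟩)

/-- It is expressible that no interpretation of the variables makes `q` true at all worlds. -/
theorem exists_no_assignment (hNeg : L.ClosedNeg) (hRetr : L.ClosedRetr) (hOr : L.ClosedOr)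
    (hEx : L.ClosedEx) (hΔ : Δ ∈ L.sig) (Y : Vars Δ) {q : Set (Sen (Δ.extv Y))}
    (hq : q.Finite) (hqL : q ⊆ L.sen (Δ.extv Y)) :
    ∃ φ ∈ L.sen Δ, ∀ (M : Kripke Δ) (w : M.W),
      φ.Sat M w ↔ ∀ κ : M.Assignment Y.toConsts, ¬ (M.expand κ).Models q := by
  have hY := L.ext_sig Δ hΔ Y.toConsts
  obtain ⟨δ, hδ, hδe⟩ := exists_conj hNeg hOr hY hq hqL
  obtain ⟨ε, hε, hεe⟩ := exists_everywhere hNeg hRetr hEx hY hδ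
  obtain ⟨φ, hφ, e⟩ := Expresses.neg hNeg hΔ (hEx Δ hΔ Y ε hε)
  refine ⟨φ, hφ, fun M w => (e M w).trans (not_exists.trans (forall_congr' fun κ => ?_))⟩
  refine not_congr ((hεe _ _).trans ?_)
  exact ⟨fun h γ hγ v => (hδe _ v).1 (h v) γ hγ, fun h v => (hδe _ v).2 fun γ hγ => h γ hγ v⟩

/-- For a substitution `θ` of variables `x` by nominals and terms over `Δ[C]`, with `C` finite, and
a finite set `q` of sentences over `Δ[C]`, the formula `∀ C (x = θ(x) → ¬ □q)` in the
variables `x` is expressible, where `□q` says that `q` is true at all worlds. -/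
theorem exists_forall_value_ne (hEq : L.ClosedEq) (hNeg : L.ClosedNeg) (hRetr : L.ClosedRetr)
    (hOr : L.ClosedOr) (hEx : L.ClosedEx) (hΔ : Δ ∈ L.sig) {X : Vars Δ} {C : Consts Δ}
    [Finite C.N] [Finite C.D] (θ : Subst (Hom.incl Δ C) X.toConsts) {q : Set (Sen (Δ.ext C))}
    (hq : q.Finite) (hqL : q ⊆ L.sen (Δ.ext C)) :
    ∃ φ ∈ L.sen (Δ.extv X), ∀ (M : Kripke Δ) (ν : M.Assignment X.toConsts) (w : M.W),
      φ.Sat (M.expand ν) w ↔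
        ∀ μ : M.Assignment C, ν = θ.value μ → ¬ (M.expand μ).Models q := by
  obtain ⟨Y, Θ, hΘ⟩ := exists_vars_of_finite X C
  have hX := L.ext_sig Δ hΔ X.toConsts
  have hY := L.ext_sig _ hX Y.toConsts
  have : Finite X.toConsts.N := inferInstanceAs (Finite (ULift (Fin X.n)))
  have : Finite X.toConsts.D := inferInstanceAs (Finite (ULift (Fin X.m)))
  choose eN heN heN' using fun x : X.toConsts.N =>
    Expresses.retr hRetr hY ((hEq _ hY).1 (Θ.toGHom.nom (θ.nom x))) (Sum.inl (Sum.inr x))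
  choose eD heD heD' using fun d : X.toConsts.D => (hEq _ hY).2 (Sum.inl (X.toConsts.srt d))
    (Term.rapp (Δ := (Δ.extv X).extv Y) (Sum.inl (Sum.inr d)) fun i => i.elim0)
    ((θ.con d).trans Θ.toGHom)
  obtain ⟨φ, hφ, hφe⟩ := exists_no_assignment hNeg hRetr hOr hEx hX Y
    (q := Sen.subst Θ '' q ∪ (Set.range eN ∪ Set.range eD))
    ((hq.image _).union ((Set.finite_range _).union (Set.finite_range _))) (by
      rintro _ (⟨γ, hγ, rfl⟩ | ⟨x, rfl⟩ | ⟨d, rfl⟩)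
      · exact L.subst_mem _ C Θ hΔ γ (hqL hγ)
      · exact heN x
      · exact heD d)
  refine ⟨φ, hφ, fun M ν w => (hφe (M.expand ν) w).trans ?_⟩
  obtain ⟨back, hback, hred⟩ := hΘ M ν
  rw [hback.forall]
  refine forall_congr' fun κ => ?_
  have hsat : ∀ (γ : Sen (Δ.ext C)) (v : M.W),
      (γ.subst Θ).Sat ((M.expand ν).expand κ) v ↔ γ.Sat (M.expand (back κ)) v := fun γ v =>
    (γ.sat_trans _ Θ.rigid_toGHom ((M.expand ν).expand κ) v v).trans
      (γ.sat_congr (hred κ v) HEq.rfl)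
  have hnom : ∀ k, ((M.expand ν).expand κ).nom (Θ.toGHom.nom k) = (M.expand (back κ)).nom k :=
    fun k => congrFun (eq_of_heq (show HEq (Θ.toGHom.reduct ((M.expand ν).expand κ) w).nom
      (M.expand (back κ)).nom by rw [hred κ w])) k
  have heval : ∀ d (v : M.W), ((θ.con d).trans Θ.toGHom).eval ((M.expand ν).expand κ) v =
      (θ.value (back κ)).con d := fun d v =>
    (eq_of_heq (GHom.eval_trans_rigidSort Θ.rigid_toGHom ((M.expand ν).expand κ) v (hred κ v)
      (θ.con d) (v := v) HEq.rfl)).trans ((θ.rigid d).eval_eq _ _ _)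
  have hν : ν = θ.value (back κ) ↔ (∀ x, ν.nom x = (θ.value (back κ)).nom x) ∧
      ∀ d, ν.con d = (θ.value (back κ)).con d :=
    ⟨fun h => h ▸ ⟨fun _ => rfl, fun _ => rfl⟩,
      fun h => congrArg₂ (Kripke.Assignment.mk (M := M)) (funext h.1) (funext h.2)⟩
  rw [← not_and, not_iff_not, hν]
  constructor
  · intro h
    refine ⟨⟨fun x => ?_, fun d => ?_⟩, fun γ hγ v => (hsat γ v).1 (h _ (.inl ⟨γ, hγ, rfl⟩) v)⟩
    · exact ((heN' x _ w).1 (h _ (.inr (.inl ⟨x, rfl⟩)) w)).symm.trans (hnom _)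
    · exact ((heD' d ((M.expand ν).expand κ) w).1 (h _ (.inr (.inr ⟨d, rfl⟩)) w)).trans (heval d w)
  · rintro ⟨⟨hn, hd⟩, h⟩ _ (⟨γ, hγ, rfl⟩ | ⟨x, rfl⟩ | ⟨d, rfl⟩) v
    · exact (hsat γ v).2 (h γ hγ v)
    · exact (heN' x _ v).2 ((hnom _).trans (hn x).symm)
    · exact (heD' d _ v).2 ((hd d).trans (heval d v).symm)

end Fragment

/-! ### Types excluded by a family of substitutions -/

namespace Fragment

variable {L : Fragment.{u}} {Δ : Signature.{u}}

/-- The type, with variables `x` from `X`, of all `L`-sentences which say `∀ C (x ≠ θ(x))` for some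
substitution `θ` in the family `F` with values over `Δ[C]`, `C` finite. -/
def typeOfSubsts (L : Fragment.{u}) {X : Vars Δ}
    (F : ∀ C : Consts Δ, Subst (Hom.incl Δ C) X.toConsts → Prop) : Set (Sen (Δ.extv X)) :=
  {γ | γ ∈ L.sen (Δ.extv X) ∧ ∃ (C : Consts Δ) (θ : Subst (Hom.incl Δ C) X.toConsts),
    Finite C.N ∧ Finite C.D ∧ F C θ ∧
      ∀ (M : Kripke Δ) (ν : M.Assignment X.toConsts) (w : M.W),
        γ.Sat (M.expand ν) w ↔ ∀ μ : M.Assignment C, ν ≠ θ.value μ}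

/-- In a structure omitting the type of a family of substitutions, every interpretation of the
variables is given by some substitution from the family. -/
theorem exists_value_of_not_realizes {X : Vars Δ}
    {F : ∀ C : Consts Δ, Subst (Hom.incl Δ C) X.toConsts → Prop} {M : Kripke Δ}
    (h : ¬ M.Realizes X (L.typeOfSubsts F)) (ν : M.Assignment X.toConsts) :
    ∃ (C : Consts Δ) (θ : Subst (Hom.incl Δ C) X.toConsts) (μ : M.Assignment C),
      F C θ ∧ ν = θ.value μ := by
  by_contra! hc
  exact h ⟨ν, fun γ ⟨_, C, θ, _, _, hF, hγ⟩ w => (hγ M ν w).2 fun μ => hc C θ μ hF⟩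

/-- If the models of `S` obey an infinitary rule which infers `∀ x φ(x)` from the instances of `φ`
under the substitutions in `F`, then every extension of `S` by one sentence locally omits the type
of `F`. If `S ∪ q` entailed all `x ≠ θ'(x)`, with `θ'` in `F`, at `θ(x)`, then the instances under
`F` of the formula `∀ C (x = θ(x) → ¬ □q)` would hold in the models of `S`; so by the rule
the formula itself would hold, and `S ∪ q` would be unsatisfiable. -/
theorem not_alphaRealizes_typeOfSubsts (hEq : L.ClosedEq) (hNeg : L.ClosedNeg)
    (hRetr : L.ClosedRetr) (hOr : L.ClosedOr) (hEx : L.ClosedEx) (hΔ : Δ ∈ L.sig) {X : Vars Δ}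
    {F : ∀ C : Consts Δ, Subst (Hom.incl Δ C) X.toConsts → Prop}
    (S : Set (Sen Δ)) {χ : Sen Δ} (hχ : χ ∈ L.sen Δ)
    (rule : ∀ φ ∈ L.sen (Δ.extv X),
      (∀ (C : Consts Δ) (θ : Subst (Hom.incl Δ C) X.toConsts), Finite C.N → Finite C.D → F C θ →
        ∀ M : Kripke Δ, M.Models S → ∀ (μ : M.Assignment C) (w : M.W),
          φ.Sat (M.expand (θ.value μ)) w) →
      ∀ M : Kripke Δ, M.Models S → ∀ (ν : M.Assignment X.toConsts) (w : M.W),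
        φ.Sat (M.expand ν) w) :
    ¬ L.AlphaRealizes Cardinal.aleph0 (insert χ S) X (L.typeOfSubsts F) := by
  rintro ⟨C, θ, p, hN, hD, hpL, hp, ⟨N, hNm⟩, hent⟩
  have := Cardinal.lt_aleph0_iff_finite.1 hN
  have := Cardinal.lt_aleph0_iff_finite.1 hD
  rw [Cardinal.lift_aleph0, Cardinal.lt_aleph0_iff_set_finite] at hp
  have hC := L.ext_sig Δ hΔ C
  obtain ⟨φ, hφ, hφe⟩ := exists_forall_value_ne hEq hNeg hRetr hOr hEx hΔ θ
    (hp.insert (χ.map (Hom.incl Δ C)))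
    (Set.insert_subset (L.map_mem _ hΔ hC (L.ext_mor Δ hΔ C) χ hχ) hpL)
  have hall := rule φ hφ ?_
  · obtain ⟨M, μ, rfl⟩ := N.exists_expand
    have hM := (M.models_map_incl μ _).1 fun γ hγ => hNm γ (.inl hγ)
    refine (hφe M (θ.value μ) (Classical.choice M.nonemptyW)).1
      (hall M (fun γ hγ => hM γ (.inr hγ)) _ _) μ rfl ?_
    rintro γ (rfl | hγ)
    · exact hNm _ (.inl ⟨χ, .inl rfl, rfl⟩)
    · exact hNm _ (.inr hγ)
  · intro C' θ' _ _ hF M hM μ' w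
    refine (hφe M _ w).2 fun μ hμ hq => ?_
    have hmod : (M.expand μ).Models (Sen.map (Hom.incl Δ C) '' insert χ S ∪ p) := by
      rintro _ (⟨γ, rfl | hγ, rfl⟩ | hγ)
      · exact hq _ (.inl rfl)
      · exact (M.models_map_incl μ S).2 hM _ ⟨γ, hγ, rfl⟩
      · exact hq _ (.inr hγ)
    obtain ⟨γ, hγ, hγe⟩ := exists_forall_value_ne hEq hNeg hRetr hOr hEx hΔ θ' (q := ∅)
      Set.finite_empty (Set.empty_subset _)
    have hγe' : ∀ (M : Kripke Δ) (ν : M.Assignment X.toConsts) (w : M.W),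
        γ.Sat (M.expand ν) w ↔ ∀ μ, ν ≠ θ'.value μ := fun M ν w =>
      (hγe M ν w).trans (forall_congr' fun μ =>
        imp_congr_right fun _ => ⟨fun h => h fun _ h => h.elim, False.elim⟩)
    have hsat := hent (M.expand μ) hmod _ ⟨γ, ⟨hγ, C', θ', ‹_›, ‹_›, hF, hγe'⟩, rfl⟩ w
    exact (hγe' M _ w).1 ((θ.sat_subst μ γ w).1 hsat) μ' hμ.symm

end Fragment

/-! ### Substitutions by nominals and by constructor terms -/

section Families

variable {Δ : Signature.{u}}

/-- The substitutions of a nominal of `Δ` for a single nominal variable. -/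
def IsNominalSubst (C : Consts Δ) (θ : Subst (Hom.incl Δ C) (Vars.nominal Δ).toConsts) : Prop :=
  ∃ k : Δ.Nom, θ.nom ⟨(0 : Fin 1)⟩ = Sum.inl k

/-- The substitutions of a constructor term with loose variables for a single variable. -/
inductive IsConstructorSubst (c : Set Δ.RFunc) (s : Δ.RSort) :
    ∀ C : Consts Δ, Subst (Hom.incl Δ C) (Vars.single s).toConsts → Prop
  | intro (Z : Vars Δ) (t : Term (Δ.extv Z) (Sum.inl s)) (ht : IsLooseConstructorTerm c Z t) :
      IsConstructorSubst c s Z.toConsts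
        (Subst.ofTerm Z.toConsts t ht.constructor_term.isRigid)

theorem IsConstructorTerm.subst {c : Set Δ.RFunc} {Y Z : Consts Δ}
    (θ : Subst (Hom.incl Δ Y) Z) (hθ : ∀ d, IsConstructorTerm c (θ.con d))
    {h : (Δ.ext Z).HSort} {t : Term (Δ.ext Z) h} (ht : IsConstructorTerm c t) :
    IsConstructorTerm c (Y := Y) (t.trans θ.toGHom) := by
  induction ht with
  | var d args => exact hθ d
  | app f hf args h ih => exact IsConstructorTerm.app f hf _ ih

/-- The value of a constructor term in finitely many loose variables is the value of a constructor
term in the standard loose variables. -/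
theorem exists_looseVars_eval {c : Set Δ.RFunc} {M : Kripke Δ} {Z : Vars Δ} (hn : Z.n = 0)
    (hZ : ∀ i, ¬ Constrained c (Z.srt i)) (μ : M.Assignment Z.toConsts) {s : Δ.RSort}
    {t : Term (Δ.extv Z) (Sum.inl s)} (ht : IsConstructorTerm c (Y := Z.toConsts) t) (w : M.W) :
    ∃ (ν : M.Assignment (looseVars c)) (t' : Term (Δ.ext (looseVars c)) (Sum.inl s)),
      IsConstructorTerm c t' ∧ t.eval (M.expand μ) w = t'.eval (M.expand ν) w := by
  have hN : IsEmpty Z.toConsts.N := ⟨fun x => (Fin.cast hn x.down).elim0⟩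
  -- The `i`-th variable of `Z` becomes the `i`-th standard variable of its sort.
  let θ : Subst (Hom.incl Δ (looseVars c)) Z.toConsts :=
    { nom := fun x => (hN.false x).elim
      con := fun d => Term.rapp (Δ := Δ.ext (looseVars c))
        (Sum.inr (⟨Z.srt d.down, hZ d.down⟩, d.down.1)) fun i => i.elim0
      rigid := fun _ i => i.elim0 }
  have hν : ∀ d : (looseVars c).D, ∃ x : M.RC d.1.1, ∀ i : Fin Z.m, Z.srt i = d.1.1 → i.1 = d.2 →
      HEq x (μ.con ⟨i⟩) := by
    rintro ⟨⟨r, hr⟩, j⟩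
    by_cases h : ∃ i : Fin Z.m, Z.srt i = r ∧ i.1 = j
    · obtain ⟨i, rfl, rfl⟩ := h
      refine ⟨μ.con ⟨i⟩, fun i' _ hi => ?_⟩
      obtain rfl := Fin.ext hi
      rfl
    · exact ⟨Classical.choice (M.nonemptyRC r), fun i h₁ h₂ => (h ⟨i, h₁, h₂⟩).elim⟩
  choose con hcon using hν
  let ν : M.Assignment (looseVars c) := ⟨PEmpty.elim, con⟩
  have hval : θ.value ν = μ := congrArg₂ (Kripke.Assignment.mk (M := M))
    (funext fun x => (hN.false x).elim)
    (funext fun d => eq_of_heq (hcon (⟨Z.srt d.down, hZ d.down⟩, d.down.1) d.down rfl rfl))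
  refine ⟨ν, t.trans θ.toGHom, ht.subst θ fun d => .var (c := c) (Y := looseVars c) _ _, ?_⟩
  have hred : θ.toGHom.reduct (M.expand ν) w = M.expand μ := hval ▸ θ.reduct_expand ν w
  exact (eq_of_heq (GHom.eval_trans_rigidSort θ.rigid_toGHom (M.expand ν) w hred t
    (v := w) HEq.rfl)).symm

end Families

/-! ### Sets of derivable sentences -/

namespace Fragment

variable {L : Fragment.{u}} {E : L.EntailmentRelation} {𝓜 : ∀ Ξ Ξ' : L.CSig, Set (L.CMor Ξ Ξ')}
  {Ξ : L.CSig}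

/-- The sentences derivable from `Φ`. -/
def derivable (E : L.EntailmentRelation) (𝓜 : ∀ Ξ Ξ' : L.CSig, Set (L.CMor Ξ Ξ')) (Ξ : L.CSig)
    (Φ : Set (L.Sentence Ξ.base.1)) : Set (L.Sentence Ξ.base.1) :=
  {φ | CDerives E 𝓜 Ξ Φ {φ}}

/-- The set of derivable sentences is closed under semantic consequence. -/
theorem mem_derivable_of_entails (hE : E.Complete) {Φ : Set (L.Sentence Ξ.base.1)}
    {φ : L.Sentence Ξ.base.1}
    (h : ∀ M : Kripke Ξ.base.1, M.Models (Subtype.val '' derivable E 𝓜 Ξ Φ) →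
      ∀ w, φ.1.Sat M w) : φ ∈ derivable E 𝓜 Ξ Φ := by
  refine .trans Ξ _ (derivable E 𝓜 Ξ Φ) _ (.union Ξ _ _ fun _ h => h) (.r0 Ξ _ _ (hE _ _ _ ?_))
  rw [Set.image_singleton]
  rintro M hM _ rfl
  exact h M hM

/-- The models of the derivable sentences obey the infinitary rule for nominals, because the
derivable sentences are closed under R1 and under semantic consequence. -/
theorem derivable_nominal_rule (hNeg : L.ClosedNeg) (hRetr : L.ClosedRetr) (hEx : L.ClosedEx)
    (hE : E.Complete) (Φ : Set (L.Sentence Ξ.base.1))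
    (φ : Sen (Ξ.base.1.extv (Vars.nominal Ξ.base.1))) (hφ : φ ∈ L.sen _)
    (h : ∀ (C : Consts Ξ.base.1) (θ : Subst (Hom.incl Ξ.base.1 C) (Vars.nominal Ξ.base.1).toConsts),
      Finite C.N → Finite C.D → IsNominalSubst C θ →
        ∀ M : Kripke Ξ.base.1, M.Models (Subtype.val '' derivable E 𝓜 Ξ Φ) →
          ∀ (μ : M.Assignment C) (w : M.W), φ.Sat (M.expand (θ.value μ)) w)
    (M : Kripke Ξ.base.1) (hM : M.Models (Subtype.val '' derivable E 𝓜 Ξ Φ))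
    (ν : M.Assignment (Vars.nominal Ξ.base.1).toConsts) (w : M.W) : φ.Sat (M.expand ν) w := by
  obtain ⟨ρ, hρ, hρe⟩ := Expresses.all hNeg hEx Ξ.base.2 ⟨φ, hφ, fun _ _ => Iff.rfl⟩
  choose σ hσ hσe using fun k₁ k₂ : Ξ.base.1.Nom => hRetr _ Ξ.base.2 _
    (L.subst_mem (Extension.refl (Δ := Ξ.base.1)) _ (Subst.ofNominal k₂) Ξ.base.2 φ hφ) k₁
  have hmem : (⟨ρ, hρ⟩ : L.Sentence Ξ.base.1) ∈ derivable E 𝓜 Ξ Φ := by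
    refine .r1 Ξ Φ ⟨φ, hφ⟩ (fun k₁ k₂ => ⟨σ k₁ k₂, hσ k₁ k₂⟩) _ hσe hρe fun k₁ k₂ => ?_
    refine mem_derivable_of_entails hE fun M hM w => (hσe k₁ k₂ M w).2 ?_
    refine (Subst.sat_subst_ofNominal k₂ M φ _).2 ?_
    let C : Vars Ξ.base.1 := ⟨0, 0, Fin.elim0⟩
    let θ : Subst (Hom.incl Ξ.base.1 C.toConsts) (Vars.nominal Ξ.base.1).toConsts :=
      ⟨fun _ => Sum.inl k₂, fun d => d.down.elim0, fun d => d.down.elim0⟩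
    let μ : M.Assignment C.toConsts := ⟨fun x => x.down.elim0, fun d => d.down.elim0⟩
    have hval : (⟨fun _ => M.nom k₂, fun d => d.down.elim0⟩ :
        M.Assignment (Vars.nominal Ξ.base.1).toConsts) = θ.value μ :=
      congrArg (Kripke.Assignment.mk (M := M) _) (funext fun d => d.down.elim0)
    rw [hval]
    exact h _ θ (inferInstanceAs (Finite (ULift (Fin 0))))
      (inferInstanceAs (Finite (ULift (Fin 0))))
      ⟨k₂, rfl⟩ M hM μ _
  exact (Sen.sat_all φ M w).1 ((hρe M w).1 (hM _ ⟨_, hmem, rfl⟩ w)) ν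

/-- The models of the derivable sentences obey the infinitary rule for constructor terms, because
the derivable sentences are closed under R2 and under semantic consequence. -/
theorem derivable_constructor_rule (hNeg : L.ClosedNeg) (hRetr : L.ClosedRetr) (hEx : L.ClosedEx)
    (hE : E.Complete) (Φ : Set (L.Sentence Ξ.base.1)) {s : Ξ.base.1.RSort}
    (hs : Constrained Ξ.cons s) (φ : Sen (Ξ.base.1.extv (Vars.single s))) (hφ : φ ∈ L.sen _)
    (h : ∀ (C : Consts Ξ.base.1) (θ : Subst (Hom.incl Ξ.base.1 C) (Vars.single s).toConsts),
      Finite C.N → Finite C.D → IsConstructorSubst Ξ.cons s C θ →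
        ∀ M : Kripke Ξ.base.1, M.Models (Subtype.val '' derivable E 𝓜 Ξ Φ) →
          ∀ (μ : M.Assignment C) (w : M.W), φ.Sat (M.expand (θ.value μ)) w)
    (M : Kripke Ξ.base.1) (hM : M.Models (Subtype.val '' derivable E 𝓜 Ξ Φ))
    (ν : M.Assignment (Vars.single s).toConsts) (w : M.W) : φ.Sat (M.expand ν) w := by
  have hΔ := Ξ.base.2
  obtain ⟨ρ, hρ, hρe⟩ := Expresses.all hNeg hEx hΔ ⟨φ, hφ, fun _ _ => Iff.rfl⟩
  choose σ hσ hσe using fun (k : Ξ.base.1.Nom) (Z : Vars Ξ.base.1)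
      (t : Term (Ξ.base.1.extv Z) (Sum.inl s)) (ht : IsLooseConstructorTerm Ξ.cons Z t) =>
    Expresses.retr hRetr hΔ (Expresses.all hNeg hEx hΔ (X := Z) ⟨_, L.subst_mem
      ((Extension.refl (Δ := Ξ.base.1)).step Z.toConsts) (Vars.single s).toConsts
      (Subst.ofTerm Z.toConsts t ht.constructor_term.isRigid) hΔ φ hφ, fun _ _ => Iff.rfl⟩) k
  have hmem : (⟨ρ, hρ⟩ : L.Sentence Ξ.base.1) ∈ derivable E 𝓜 Ξ Φ := by
    refine .r2 Ξ Φ s hs ⟨φ, hφ⟩ (fun k Z t ht => ⟨σ k Z t ht, hσ k Z t ht⟩) _ hσe hρe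
      fun k Z t ht => ?_
    refine mem_derivable_of_entails hE fun M hM w => (hσe k Z t ht M w).2 ?_
    refine (Sen.sat_all _ M _).2 fun μ => (Subst.sat_subst _ μ φ _).2 ?_
    exact h _ _ (inferInstanceAs (Finite (ULift (Fin Z.n))))
      (inferInstanceAs (Finite (ULift (Fin Z.m))))
      ⟨Z, t, ht⟩ M hM μ _
  exact (Sen.sat_all φ M w).1 ((hρe M w).1 (hM _ ⟨_, hmem, rfl⟩ w)) ν

/-- A structure is constructor-based if it omits the type of an unnamed world and, for each
constrained sort, the type of an element which is not the value of a constructor term. -/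
theorem _root_.HDFOLR.Kripke.constructorBased_of_omits {Δ : Signature.{u}} {c : Set Δ.RFunc}
    {M : Kripke Δ} (h₁ : ¬ M.Realizes (Vars.nominal Δ) (L.typeOfSubsts IsNominalSubst))
    (h₂ : ∀ s, Constrained c s →
      ¬ M.Realizes (Vars.single s) (L.typeOfSubsts (IsConstructorSubst c s))) :
    M.ConstructorBased c := by
  refine ⟨fun w => ?_, fun s w m => ?_⟩
  · obtain ⟨C, θ, μ, ⟨k, hk⟩, hν⟩ := exists_value_of_not_realizes h₁
      ⟨fun _ => w, fun d => d.down.elim0⟩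
    refine ⟨k, (congrFun (congrArg Kripke.Assignment.nom hν) ⟨(0 : Fin 1)⟩).trans ?_⟩
    exact congrArg (M.expand μ).nom hk
  · by_cases hs : Constrained c s
    · obtain ⟨_, _, μ, ⟨Z, t, ht⟩, hν⟩ := exists_value_of_not_realizes (h₂ s hs)
        ⟨fun x => x.down.elim0, fun _ => m⟩
      have hm : m = t.eval (M.expand μ) w :=
        (congrFun (congrArg Kripke.Assignment.con hν) ⟨(0 : Fin 1)⟩).trans
          (ht.constructor_term.isRigid.eval_eq _ _ _)
      obtain ⟨ν, t', ht', e⟩ :=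
        exists_looseVars_eval ht.no_nominals ht.loose μ ht.constructor_term w
      exact ⟨ν, t', ht', hm.trans e⟩
    · obtain ⟨ν, t', ht', e⟩ := exists_looseVars_eval (c := c) (Z := Vars.single s) rfl
        (fun _ => hs) (⟨fun x => x.down.elim0, fun _ => m⟩ : M.Assignment (Vars.single s).toConsts)
        (.var (c := c) (Y := (Vars.single s).toConsts) ⟨(0 : Fin 1)⟩ fun i => i.elim0) w
      exact ⟨ν, t', ht', e⟩

theorem countable_rSort {Δ : Signature.{u}} (h : Δ.power ≤ Cardinal.aleph0) :
    Countable Δ.RSort := by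
  refine Cardinal.mk_le_aleph0_iff.1 (le_trans ?_ ((le_max_right _ _).trans h))
  calc Cardinal.mk Δ.RSort
      ≤ Cardinal.mk Δ.Nom + Cardinal.mk Δ.Mod + Cardinal.mk Δ.RSort := self_le_add_left _ _
    _ ≤ _ := by simp only [add_assoc]; gcongr; exact self_le_add_right _ _

end Fragment

end HDFOLR

open HDFOLR HDFOLR.Fragment in
theorem mainTheorem3 (L : HDFOLR.Fragment.{u})
    (hEq : L.ClosedEq) (hNeg : L.ClosedNeg) (hRetr : L.ClosedRetr) (hOr : L.ClosedOr)
    (hEx : L.ClosedEx)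
    (E : L.EntailmentRelation) (hE : E.Complete)
    (hOTP : L.AlphaOTP Cardinal.aleph0)
    (𝓜 : ∀ Ξ Ξ' : L.CSig, Set (L.CMor Ξ Ξ'))
    (Ξ : L.CSig) (hΞ : Ξ.base.1.power ≤ Cardinal.aleph0)
    (Φ Ψ : Set (L.Sentence Ξ.base.1)) :
    HDFOLR.Fragment.CEntails Ξ Φ Ψ → HDFOLR.Fragment.CDerives E 𝓜 Ξ Φ Ψ := by
  intro hΦΨ
  refine .union Ξ Φ Ψ fun ψ hψ => ?_
  by_contra hnot
  have hΔ := Ξ.base.2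
  let S : Set (Sen Ξ.base.1) := Subtype.val '' derivable E 𝓜 Ξ Φ
  -- `χ` says that `ψ` fails at some world.
  obtain ⟨ε, hε, hεe⟩ := exists_everywhere hNeg hRetr hEx hΔ ψ.2
  obtain ⟨χ, hχ, hχe⟩ := hNeg _ hΔ ε hε
  have hχ' : ∀ (M : Kripke Ξ.base.1) (w : M.W), χ.Sat M w ↔ ∃ v, ¬ ψ.1.Sat M v := fun M w =>
    ((hχe M w).trans (not_congr (hεe M w))).trans not_forall
  have hsat : Satisfiable (insert χ S) := by
    by_contra hunsat
    refine hnot (mem_derivable_of_entails hE fun M hM w => ?_)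
    by_contra hw
    refine hunsat ⟨M, ?_⟩
    rintro γ (rfl | hγ) v
    · exact (hχ' M v).2 ⟨w, hw⟩
    · exact hM γ hγ v
  have hSL : insert χ S ⊆ L.sen Ξ.base.1 := by
    rintro γ (rfl | ⟨γ, _, rfl⟩)
    · exact hχ
    · exact γ.2
  have := countable_rSort hΞ
  let A := {s : Ξ.base.1.RSort // Constrained Ξ.cons s}
  let X : Option A → Vars Ξ.base.1 := fun o => o.elim (Vars.nominal _) fun s => Vars.single s.1
  let Γ : ∀ o : Option A, Set (Sen (Ξ.base.1.extv (X o)))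
    | none => L.typeOfSubsts IsNominalSubst
    | some s => L.typeOfSubsts (IsConstructorSubst Ξ.cons s.1)
  -- The factor `ℕ` only repeats the types, so that there are exactly `ℵ₀` of them.
  obtain ⟨M, hM, hom⟩ := hOTP _ hΔ hΞ (insert χ S) hSL hsat (Option A × ULift.{u} ℕ)
    (Cardinal.mk_eq_aleph0 _) (fun i => X i.1) (fun i => Γ i.1)
    (by rintro ⟨_ | s, _⟩ γ hγ <;> exact hγ.1)
    (by
      rintro ⟨_ | s, _⟩
      · exact not_alphaRealizes_typeOfSubsts hEq hNeg hRetr hOr hEx hΔ S hχ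
          (derivable_nominal_rule hNeg hRetr hEx hE Φ)
      · exact not_alphaRealizes_typeOfSubsts hEq hNeg hRetr hOr hEx hΔ S hχ
          (derivable_constructor_rule hNeg hRetr hEx hE Φ s.2))
  have hcb : M.ConstructorBased Ξ.cons := Kripke.constructorBased_of_omits (L := L)
    (hom (none, ⟨0⟩)) fun s hs => hom (some ⟨s, hs⟩, ⟨0⟩)
  have hΦ : M.Models (Subtype.val '' Φ) := by
    rintro _ ⟨φ, hφ, rfl⟩
    exact hM _ (.inr ⟨φ, .mono Ξ _ _ (Set.singleton_subset_iff.2 hφ), rfl⟩)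
  obtain ⟨w⟩ := M.nonemptyW
  obtain ⟨v, hv⟩ := (hχ' M w).1 (hM χ (.inl rfl) w)
  exact hv (hΦΨ M hcb hΦ ψ.1 ⟨ψ, hψ, rfl⟩ v)
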